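/- Let $n\ge 0$ be an integer, $d_0>0$, and let $H$ be a function which is real-analytic in a neighbourhood of $[0,d_0)$ with $H>0$ and $H'<0$ on $[0,d_0)$ (for example, $H(d)$ is the mean curvature of the parallel hypersurface at distance $d$ from a strictly mean convex isoparametric hypersurface $\Gamma\subset\mathbb S^n$, and $d_0$ is the distance to the minimal hypersurface of the family). Consider the singular initial value problem $$(1-2ns)\gamma'(s)-H(\gamma(s))+4\,\frac{s\gamma'(s)+s^2\gamma''(s)}{1+4s^2\gamma'(s)^2}=0\quad(0<s\le s_0),\qquad \gamma(0)=0. \tag{1}$$ Then there is $s_0>0$, depending only on $n,H,d_0$, such that (1) has a unique solution $\gamma\in C^\infty[0,s_0]$ with values in $[0,d_0)$, and $\gamma'>0$ on $[0,s_0]$. Moreover: (i) There is $M_0>0$ such that for every $M\ge M_0$ there is $r_0>0$ such that for every $0<r\le r_0$ the rescaled solution $\tilde\gamma(s)=\gamma(rs)$, $0\le s\le s_0/r$, satisfies $$\|\tilde\gamma^{(j)}\|_{L^2[0,s]}+\Bigl|\Bigl(\frac{d}{ds}\Bigr)^{j-1}\bigl(s\tilde\gamma'(s)\bigr)\Bigr|\le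 M^{j-3}\,\frac{((j-2)!)^2}{j-1}\qquad\text{for all integers } j\ge 2 \text{ and all } 0\le s\le s_0/r .$$ (ii) $\gamma$ is in the Gevrey class $\mathcal G^2[0,s_0]$, where $f\in\mathcal G^2[a,b]$ means that $f\in C^\infty[a,b]$ and that there is $C>0$ with $|f^{(k)}(x)|\le C^{k+1}(k!)^2$ for all $k\ge 0$, $x\in[a,b]$. (iii) $\gamma$ is a bijection of $[0,s_0]$ onto $[0,\gamma(s_0)]$ whose inverse $g$ is in $\mathcal G^2[0,\gamma(s_0)]$. Here $g=e^{-2\varphi}$ on $(0,\gamma(s_0)]$, where $\varphi$ is a solution of the radial graph self-shrinker equation $$\frac{\varphi''}{1+\varphi'^2}+H(d)\,\varphi'=n-\tfrac12e^{2\varphi}\qquad\text{on } (0,\gamma(s_0)).$$ -/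

import Mathlib

open scoped ContDiff

noncomputable section

/-- The hypotheses on the mean curvature `H(d)` of the parallel hypersurfaces, for distances
`d` in `[0, d₀)`: it is real-analytic, positive and strictly decreasing (with negative
derivative). -/
structure IsMeanCurvatureProfile (H : ℝ → ℝ) (d₀ : ℝ) : Prop where
  pos_d₀ : 0 < d₀
  analytic : AnalyticOnNhd ℝ H (Set.Ico 0 d₀)
  pos : ∀ d ∈ Set.Ico 0 d₀, 0 < H d
  deriv_neg : ∀ d ∈ Set.Ico 0 d₀, deriv H d < 0

/-- `γ ∈ C^∞[0, s₀]` (one-sided derivatives at the end points), with values in the interval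
`[0, d₀)` on which `H` is given, solves the singular initial value problem
`(1 - 2ns) γ' - H(γ) + 4 (s γ' + s² γ'') / (1 + 4 s² γ'²) = 0` for `0 < s ≤ s₀`, `γ(0) = 0`. -/
structure IsSmoothSolution (n : ℕ) (H : ℝ → ℝ) (d₀ s₀ : ℝ) (γ : ℝ → ℝ) : Prop where
  smooth : ContDiffOn ℝ ∞ γ (Set.Icc 0 s₀)
  init : γ 0 = 0
  mapsTo : Set.MapsTo γ (Set.Icc 0 s₀) (Set.Ico 0 d₀)
  ode : ∀ s ∈ Set.Ioc 0 s₀,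
    (1 - 2 * (n : ℝ) * s) * derivWithin γ (Set.Icc 0 s₀) s - H (γ s)
      + 4 * ((s * derivWithin γ (Set.Icc 0 s₀) s
              + s ^ 2 * iteratedDerivWithin 2 γ (Set.Icc 0 s₀) s)
            / (1 + 4 * s ^ 2 * (derivWithin γ (Set.Icc 0 s₀) s) ^ 2)) = 0

/-- The norm of `f` in `L²[0, s]` (used for `0 ≤ s` and `f` continuous on `[0, s]`). -/
def l2NormUpTo (s : ℝ) (f : ℝ → ℝ) : ℝ :=
  Real.sqrt (∫ t in (0 : ℝ)..s, f t ^ 2)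

/-- `‖f^{(j)}‖_{L²[0,s]} + |(d/ds)^{j-1} (s f'(s))|` for a function `f` on `[0, L]`
and `0 ≤ s ≤ L`, `1 ≤ j`. -/
def energyQuantity (L : ℝ) (f : ℝ → ℝ) (j : ℕ) (s : ℝ) : ℝ :=
  l2NormUpTo s (iteratedDerivWithin j f (Set.Icc 0 L))
    + |iteratedDerivWithin (j - 1) (fun t => t * derivWithin f (Set.Icc 0 L) t)
        (Set.Icc 0 L) s|

/-- `f` belongs to the Gevrey class of order `σ` on the compact interval `[a, b]`:
`f ∈ C^∞[a, b]` and `|f^{(k)}| ≤ C^{k+1} (k!)^σ` on `[a, b]` for all `k`. -/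
def GevreyOn (σ : ℕ) (f : ℝ → ℝ) (a b : ℝ) : Prop :=
  ContDiffOn ℝ ∞ f (Set.Icc a b) ∧
    ∃ C : ℝ, 0 < C ∧ ∀ k : ℕ, ∀ x ∈ Set.Icc a b,
      |iteratedDerivWithin k f (Set.Icc a b) x| ≤ C ^ (k + 1) * (Nat.factorial k : ℝ) ^ σ

/-- The equation `φ'' / (1 + φ'²) + H φ' = n - e^{2φ} / 2` on the open interval `(0, d₁)`,
satisfied by the height `φ(d)` of the radial graph of a self-shrinker. -/
def SolvesRadialGraphEquation (n : ℕ) (H : ℝ → ℝ) (d₁ : ℝ) (φ : ℝ → ℝ) : Prop :=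
  ContDiffOn ℝ 2 φ (Set.Ioo 0 d₁) ∧
    ∀ d ∈ Set.Ioo 0 d₁,
      deriv (deriv φ) d / (1 + (deriv φ d) ^ 2) + deriv φ d * H d
        = (n : ℝ) - 1 / 2 * Real.exp (2 * φ d)

end

/-! With `w = γ'`, clearing the denominator turns the problem into `4 s² w' + w = F(s, H(γ), w)`,
where `w` enters `F` only with a factor `s`. The operator on the left is singular at `0` but obeys a
maximum principle on `[0, L]`: a positive maximum point has `w' ≥ 0`, so `w` is bounded by the
right-hand side there, and the value at `0` is dictated by the equation.

Differentiating `4 s² w' + w = f` `k` times gives `4 s² V' + (1 + 8ks) V = f^{(k)} - 4k(k-1)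
w^{(k-1)}` for `V = w^{(k)}`. The new zeroth-order term has the good sign, and since `k(k-1)
((k-1)!)² ≤ (k!)²`, bounds `W R^k (k!)²` reproduce themselves with a loss of only `4W/R`. This is
the source of Gevrey order two (`GevreyBound.exists_solution`). Such bounds are stable under
products and under composition with analytic functions (`GevreyBound.mul`, `GevreyBound.comp`),
because sums of reciprocal binomial coefficients are bounded.

Hence Picard iteration preserves one fixed Gevrey class when `R` is large, and contracts in the sup
norm when `L` is small. Its limit is the solution (`exists_gevrey_solution`). Uniqueness among all
smooth solutions comes from the maximum principle in an exponentially weighted norm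
(`eq_zero_of_singular_ode`).

The inverse solves `g' = (1/w)(g)`, whose Gevrey regularity follows by bounding the iterates of the
vector field (`gevreyOn_of_autonomous_ode`). The energy estimate follows from the Gevrey bounds of
`γ`: rescaling by a small `r` makes the geometric rate `r R` as small as needed. -/

open Set Filter Topology

/-! ### Calculus of Gevrey bounds of order two -/

/-- `f` is smooth on `[0, L]` and `|f^{(k)}| ≤ A R^k (k!)²` there for all `k`. -/
structure GevreyBound (L R A : ℝ) (f : ℝ → ℝ) : Prop where
  contDiffOn : ContDiffOn ℝ ∞ f (Icc 0 L)
  bound : ∀ k : ℕ, ∀ x ∈ Icc 0 L,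
    |iteratedDerivWithin k f (Icc 0 L) x| ≤ A * R ^ k * (Nat.factorial k : ℝ) ^ 2

/-- Regularity is repeatedly obtained by writing down an explicit tower of successive one-sided
derivatives; this and the next lemma convert such a tower into `iteratedDerivWithin` and smoothness.
-/
theorem iteratedDerivWithin_eqOn_of_hasDerivWithinAt {s : Set ℝ} (hs : UniqueDiffOn ℝ s)
    {F : ℕ → ℝ → ℝ} (hF : ∀ k, ∀ x ∈ s, HasDerivWithinAt (F k) (F (k + 1) x) s x) (k : ℕ) :
    EqOn (iteratedDerivWithin k (F 0) s) (F k) s := by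
  induction k with
  | zero => intro x _; simp
  | succ k ih =>
    intro x hx
    rw [iteratedDerivWithin_succ, derivWithin_congr ih (ih hx)]
    exact (hF k x hx).derivWithin (hs x hx)

theorem contDiffOn_infty_of_hasDerivWithinAt {s : Set ℝ} (hs : UniqueDiffOn ℝ s)
    {F : ℕ → ℝ → ℝ} (hF : ∀ k, ∀ x ∈ s, HasDerivWithinAt (F k) (F (k + 1) x) s x) :
    ContDiffOn ℝ ∞ (F 0) s := by
  refine contDiffOn_of_differentiableOn_deriv (n := ⊤) fun m _ x hx => ?_
  have h := iteratedDerivWithin_eqOn_of_hasDerivWithinAt hs hF m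
  exact ((hF m x hx).congr (fun y hy => h hy) (h hx)).differentiableWithinAt

theorem ContDiffOn.hasDerivWithinAt_iteratedDerivWithin {s : Set ℝ} (hs : UniqueDiffOn ℝ s)
    {f : ℝ → ℝ} (hf : ContDiffOn ℝ ∞ f s) (k : ℕ) {x : ℝ} (hx : x ∈ s) :
    HasDerivWithinAt (iteratedDerivWithin k f s) (iteratedDerivWithin (k + 1) f s x) s x := by
  rw [iteratedDerivWithin_succ]
  exact (hf.differentiableOn_iteratedDerivWithin
    (by exact_mod_cast WithTop.coe_lt_coe.2 (ENat.natCast_lt_top k)) hs x hx).hasDerivWithinAt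

theorem le_choose_of_pos_of_lt {n k : ℕ} (hk : 0 < k) (hkn : k < n) : n ≤ n.choose k := by
  induction n generalizing k with
  | zero => omega
  | succ n ih =>
    obtain ⟨j, rfl⟩ : ∃ j, k = j + 1 := ⟨k - 1, by omega⟩
    rw [Nat.choose_succ_succ']
    have h1 := Nat.choose_pos (show j ≤ n by omega)
    rcases Nat.lt_or_ge (j + 1) n with h | h
    · have : n ≤ n.choose (j + 1) := ih (Nat.succ_pos j) h
      omega
    · obtain rfl : n = j + 1 := by omega
      simp

/-- The two extreme terms are `1`, and every other binomial coefficient is at least the upper index,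
so the remaining terms add up to at most `1`. Independence of `N` is the point. -/
theorem sum_inv_choose_le_three (N : ℕ) :
    ∑ i ∈ Finset.range (N + 1), (1 : ℝ) / (N.choose i : ℝ) ≤ 3 := by
  rcases N with _ | N
  · norm_num
  rw [Finset.sum_range_succ, Finset.sum_range_succ']
  have h : ∀ i ∈ Finset.range N, (1 : ℝ) / ((N + 1).choose (i + 1) : ℝ) ≤ 1 / (N + 1 : ℝ) := by
    intro i hi
    have hi' := Finset.mem_range.1 hi
    have h1' : (N + 1 : ℝ) ≤ ((N + 1).choose (i + 1) : ℝ) := by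
      exact_mod_cast le_choose_of_pos_of_lt (Nat.succ_pos i) (by omega)
    exact one_div_le_one_div_of_le (by positivity) h1'
  have h2 := Finset.sum_le_sum h
  rw [Finset.sum_const, Finset.card_range, nsmul_eq_mul] at h2
  have h3 : (N : ℝ) * (1 / (N + 1)) ≤ 1 := by
    rw [mul_one_div, div_le_one (by positivity)]; linarith
  simp only [Nat.choose_zero_right, Nat.choose_self, Nat.cast_one]
  linarith

theorem sum_inv_choose_sub_le_three {k N : ℕ} (h : k ≤ N) :
    ∑ i ∈ Finset.range (k + 1), (1 : ℝ) / (N.choose (k - i) : ℝ) ≤ 3 := by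
  have := Finset.sum_range_reflect (fun i => (1 : ℝ) / (N.choose i : ℝ)) (k + 1)
  simp only [Nat.add_sub_cancel] at this
  rw [this]
  refine le_trans (Finset.sum_le_sum_of_subset_of_nonneg ?_ fun i _ _ => by positivity)
    (sum_inv_choose_le_three N)
  exact Finset.range_subset_range.2 (by omega)

theorem abs_iteratedDerivWithin_mul_le {s : Set ℝ} (hs : UniqueDiffOn ℝ s) {f g : ℝ → ℝ}
    (hf : ContDiffOn ℝ ∞ f s) (hg : ContDiffOn ℝ ∞ g s) (k : ℕ) {x : ℝ} (hx : x ∈ s)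
    {a b : ℕ → ℝ} (ha : ∀ i ≤ k, |iteratedDerivWithin i f s x| ≤ a i)
    (hb : ∀ i ≤ k, |iteratedDerivWithin i g s x| ≤ b i) :
    |iteratedDerivWithin k (fun y => f y * g y) s x| ≤
      ∑ i ∈ Finset.range (k + 1), (k.choose i : ℝ) * a i * b (k - i) := by
  have h := iteratedDerivWithin_mul (n := k) hx hs ((hf x hx).of_le (by exact_mod_cast le_top))
    ((hg x hx).of_le (by exact_mod_cast le_top))
  change |iteratedDerivWithin k (f * g) s x| ≤ _
  rw [h]
  refine (Finset.abs_sum_le_sum_abs _ _).trans (Finset.sum_le_sum fun i hi => ?_)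
  have hi' : i ≤ k := by have := Finset.mem_range.1 hi; omega
  rw [abs_mul, abs_mul, Nat.abs_cast]
  have h1 := ha i hi'
  have h2 := hb (k - i) (Nat.sub_le _ _)
  have h3 := (abs_nonneg _).trans h1
  gcongr

namespace GevreyBound

variable {L R A B W : ℝ} {f g γ w H : ℝ → ℝ}

theorem nonneg (hL : 0 < L) (hf : GevreyBound L R A f) : 0 ≤ A := by
  have := hf.bound 0 0 ⟨le_rfl, hL.le⟩
  simp at this
  exact (abs_nonneg _).trans this

theorem abs_le (hf : GevreyBound L R A f) {x : ℝ} (hx : x ∈ Icc 0 L) : |f x| ≤ A := by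
  simpa using hf.bound 0 x hx

theorem congr (hf : GevreyBound L R A f) (h : EqOn g f (Icc 0 L)) : GevreyBound L R A g :=
  ⟨hf.contDiffOn.congr h, fun k x hx => by
    rw [iteratedDerivWithin_congr h hx]; exact hf.bound k x hx⟩

theorem add (hL : 0 < L) (hf : GevreyBound L R A f) (hg : GevreyBound L R B g) :
    GevreyBound L R (A + B) (fun x => f x + g x) :=
  ⟨hf.contDiffOn.add hg.contDiffOn, fun k x hx => by
    rw [iteratedDerivWithin_fun_add hx (uniqueDiffOn_Icc hL)
      ((hf.contDiffOn x hx).of_le (by exact_mod_cast le_top))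
      ((hg.contDiffOn x hx).of_le (by exact_mod_cast le_top))]
    refine (abs_add_le _ _).trans ?_
    rw [add_mul, add_mul]
    exact add_le_add (hf.bound k x hx) (hg.bound k x hx)⟩

theorem const_mul (c : ℝ) (hf : GevreyBound L R A f) :
    GevreyBound L R (|c| * A) (fun x => c * f x) :=
  ⟨contDiffOn_const.mul hf.contDiffOn, fun k x hx => by
    rw [iteratedDerivWithin_const_mul_field, abs_mul, mul_assoc, mul_assoc, ← mul_assoc A]
    exact mul_le_mul_of_nonneg_left (hf.bound k x hx) (abs_nonneg c)⟩

/-- Since `C(k,i) (i!)² ((k-i)!)² = (k!)² / C(k,i)`, the Leibniz sum is `(k!)²` times a sum of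
reciprocal binomial coefficients. -/
theorem mul (hL : 0 < L) (hR : 0 ≤ R) (hf : GevreyBound L R A f) (hg : GevreyBound L R B g) :
    GevreyBound L R (3 * A * B) (fun x => f x * g x) := by
  refine ⟨hf.contDiffOn.mul hg.contDiffOn, fun k x hx => ?_⟩
  have hA := hf.nonneg hL
  have hB := hg.nonneg hL
  refine (abs_iteratedDerivWithin_mul_le (uniqueDiffOn_Icc hL) hf.contDiffOn hg.contDiffOn k hx
    (fun i _ => hf.bound i x hx) (fun i _ => hg.bound i x hx)).trans ?_
  have h : ∀ i ∈ Finset.range (k + 1),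
      (k.choose i : ℝ) * (A * R ^ i * (i.factorial : ℝ) ^ 2) *
        (B * R ^ (k - i) * ((k - i).factorial : ℝ) ^ 2)
      = A * B * R ^ k * (k.factorial : ℝ) ^ 2 * (1 / (k.choose i : ℝ)) := by
    intro i hi
    have hi' : i ≤ k := by have := Finset.mem_range.1 hi; omega
    have h1 : (k.choose i : ℝ) * i.factorial * (k - i).factorial = k.factorial := by
      exact_mod_cast Nat.choose_mul_factorial_mul_factorial hi'
    have h2 : (k.choose i : ℝ) ≠ 0 := by exact_mod_cast (Nat.choose_pos hi').ne'
    have h3 : R ^ i * R ^ (k - i) = R ^ k := by rw [← pow_add]; congr 1; omega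
    rw [← h1, ← h3]
    field_simp
  rw [Finset.sum_congr rfl h, ← Finset.mul_sum]
  have := sum_inv_choose_le_three k
  calc _ ≤ A * B * R ^ k * (k.factorial : ℝ) ^ 2 * 3 := by gcongr
    _ = _ := by ring

/-- Integration shifts the order by one and so gains a factor `1/R`; only the value of `γ` itself
needs a separate bound. -/
theorem of_hasDerivWithinAt (hL : 0 < L) (hR : 0 < R) (hW : 0 ≤ W)
    (hγ : ∀ x ∈ Icc 0 L, HasDerivWithinAt γ (w x) (Icc 0 L) x)
    (hγ0 : ∀ x ∈ Icc 0 L, |γ x| ≤ W / R) (hw : GevreyBound L R W w) :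
    GevreyBound L R (W / R) γ := by
  let F : ℕ → ℝ → ℝ := fun k => Nat.casesOn k γ fun k => iteratedDerivWithin k w (Icc 0 L)
  have hF : ∀ k, ∀ x ∈ Icc 0 L, HasDerivWithinAt (F k) (F (k + 1) x) (Icc 0 L) x := by
    intro k x hx
    rcases k with _ | k
    · simpa [F] using hγ x hx
    · exact hw.contDiffOn.hasDerivWithinAt_iteratedDerivWithin (uniqueDiffOn_Icc hL) k hx
  refine ⟨contDiffOn_infty_of_hasDerivWithinAt (uniqueDiffOn_Icc hL) hF, fun k x hx => ?_⟩
  rw [show γ = F 0 from rfl,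
    iteratedDerivWithin_eqOn_of_hasDerivWithinAt (F := F) (uniqueDiffOn_Icc hL) hF k hx]
  rcases k with _ | k
  · simpa [F] using hγ0 x hx
  · refine (hw.bound k x hx).trans ?_
    rw [pow_succ R, show W / R * (R ^ k * R) = W * R ^ k by field_simp]
    gcongr
    omega

theorem contDiffOn_primitive (hL : 0 < L)
    (hγ : ∀ x ∈ Icc 0 L, HasDerivWithinAt γ (w x) (Icc 0 L) x)
    (hw : ContDiffOn ℝ ∞ w (Icc 0 L)) : ContDiffOn ℝ ∞ γ (Icc 0 L) := by
  let F : ℕ → ℝ → ℝ := fun k => Nat.casesOn k γ fun k => iteratedDerivWithin k w (Icc 0 L)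
  refine contDiffOn_infty_of_hasDerivWithinAt (F := F) (uniqueDiffOn_Icc hL) ?_
  intro k x hx
  rcases k with _ | k
  · simpa [F] using hγ x hx
  · exact hw.hasDerivWithinAt_iteratedDerivWithin (uniqueDiffOn_Icc hL) k hx

/-- Composition of an analytic function with a primitive of a function with Gevrey bounds. -/
theorem comp (hL : 0 < L) (hR : 0 ≤ R) (hB : 0 ≤ B)
    (hγ : ∀ x ∈ Icc 0 L, HasDerivWithinAt γ (w x) (Icc 0 L) x) (hw : GevreyBound L R W w)
    (hHan : ∀ x ∈ Icc 0 L, AnalyticAt ℝ H (γ x))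
    (hH : ∀ m : ℕ, ∀ x ∈ Icc 0 L, |iteratedDeriv m H (γ x)| ≤ A * B ^ m * m.factorial)
    (hBW : 3 * B * W ≤ R) : GevreyBound L R A (fun x => H (γ x)) := by
  have hu := uniqueDiffOn_Icc hL
  have hγs : ContDiffOn ℝ ∞ γ (Icc 0 L) := contDiffOn_primitive hL hγ hw.contDiffOn
  have hW := hw.nonneg hL
  have hA : 0 ≤ A := by
    have := hH 0 0 ⟨le_rfl, hL.le⟩
    simp at this
    exact (abs_nonneg _).trans this
  have han : ∀ m : ℕ, ∀ x ∈ Icc 0 L, AnalyticAt ℝ (iteratedDeriv m H) (γ x) := by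
    intro m x hx
    rw [iteratedDeriv_eq_iterate]
    exact (hHan x hx).iterated_deriv m
  have hs : ∀ m : ℕ, ContDiffOn ℝ ∞ (fun x => iteratedDeriv m H (γ x)) (Icc 0 L) := by
    intro m x hx
    exact ((han m x hx).contDiffAt (n := ∞)).comp_contDiffWithinAt x (hγs x hx)
  have hd : ∀ m : ℕ, EqOn (derivWithin (fun x => iteratedDeriv m H (γ x)) (Icc 0 L))
      (fun x => iteratedDeriv (m + 1) H (γ x) * w x) (Icc 0 L) := by
    intro m x hx
    have h1 : HasDerivAt (iteratedDeriv m H) (iteratedDeriv (m + 1) H (γ x)) (γ x) := by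
      rw [iteratedDeriv_succ]
      exact (han m x hx).differentiableAt.hasDerivAt
    exact (h1.comp_hasDerivWithinAt x (hγ x hx)).derivWithin (hu x hx)
  -- The derivative of `H^{(m)}(γ)` is `H^{(m+1)}(γ) w`, so all `m` must be treated together. The
  -- weight `(m+k)! k!` interpolates between the analytic `m!` at `k = 0` and the Gevrey `(k!)²` at
  -- `m = 0`; no Faà di Bruno formula is needed.
  have key : ∀ k m : ℕ, ∀ x ∈ Icc 0 L,
      |iteratedDerivWithin k (fun x => iteratedDeriv m H (γ x)) (Icc 0 L) x| ≤
        A * B ^ m * R ^ k * (m + k).factorial * k.factorial := by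
    intro k
    induction k using Nat.strong_induction_on with
    | _ k ih =>
    rcases k with _ | k
    · intro m x hx
      simpa using hH m x hx
    intro m x hx
    rw [iteratedDerivWithin_succ', iteratedDerivWithin_congr (hd m) hx]
    refine (abs_iteratedDerivWithin_mul_le hu (hs (m + 1)) hw.contDiffOn k hx
      (fun i hi => ih i (by omega) (m + 1) x hx) (fun i _ => hw.bound i x hx)).trans ?_
    have h : ∀ i ∈ Finset.range (k + 1),
        (k.choose i : ℝ) * (A * B ^ (m + 1) * R ^ i * (m + 1 + i).factorial * i.factorial) *
          (W * R ^ (k - i) * ((k - i).factorial : ℝ) ^ 2)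
        = A * B ^ (m + 1) * W * R ^ k * k.factorial * (m + 1 + k).factorial
            * (1 / ((m + 1 + k).choose (k - i) : ℝ)) := by
      intro i hi
      have hi' : i ≤ k := by have := Finset.mem_range.1 hi; omega
      have h1 : (k.choose i : ℝ) * i.factorial * (k - i).factorial = k.factorial := by
        exact_mod_cast Nat.choose_mul_factorial_mul_factorial hi'
      have h2 : ((m + 1 + k).choose (k - i) : ℝ) ≠ 0 := by
        exact_mod_cast (Nat.choose_pos (show k - i ≤ m + 1 + k by omega)).ne'
      have h4 : ((m + 1 + k).choose (k - i) : ℝ) * (k - i).factorial * (m + 1 + i).factorial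
          = (m + 1 + k).factorial := by
        have := Nat.choose_mul_factorial_mul_factorial (show k - i ≤ m + 1 + k by omega)
        rw [show m + 1 + k - (k - i) = m + 1 + i by omega] at this
        exact_mod_cast this
      have h3 : R ^ i * R ^ (k - i) = R ^ k := by rw [← pow_add]; congr 1; omega
      rw [← h1, ← h3, ← h4]
      field_simp
    rw [Finset.sum_congr rfl h, ← Finset.mul_sum]
    have h3 := sum_inv_choose_sub_le_three (show k ≤ m + 1 + k by omega)
    have h5 : (k.factorial : ℝ) ≤ (k + 1).factorial := by
      exact_mod_cast Nat.factorial_le (by omega)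
    calc _ ≤ A * B ^ (m + 1) * W * R ^ k * k.factorial * (m + 1 + k).factorial * 3 := by gcongr
      _ = A * B ^ m * R ^ k * k.factorial * (m + 1 + k).factorial * (3 * B * W) := by ring
      _ ≤ A * B ^ m * R ^ k * (k + 1).factorial * (m + 1 + k).factorial * R := by gcongr
      _ = _ := by rw [show m + 1 + k = m + (k + 1) by omega]; ring
  refine ⟨hs 0, fun k x hx => ?_⟩
  have := key k 0 x hx
  simp only [iteratedDeriv_zero, pow_zero, mul_one, zero_add] at this
  rw [pow_two, ← mul_assoc]
  exact this

end GevreyBound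

/-! ### Uniform Cauchy estimates near a point -/

/-- Cauchy estimates for the derivatives of a real-analytic function. -/
theorem AnalyticAt.exists_abs_iteratedDeriv_le {H : ℝ → ℝ} {x₀ : ℝ} (hH : AnalyticAt ℝ H x₀) :
    ∃ δ > 0, ∃ A B : ℝ, 0 ≤ A ∧ 0 ≤ B ∧ ∀ x, |x - x₀| ≤ δ → AnalyticAt ℝ H x ∧
      ∀ m : ℕ, |iteratedDeriv m H x| ≤ A * B ^ m * m.factorial := by
  obtain ⟨p, ρ, hp⟩ := hH
  obtain ⟨r, hr0, hr⟩ := ENNReal.lt_iff_exists_nnreal_btwn.1 hp.r_pos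
  have hr0' : 0 < r := by exact_mod_cast hr0
  have hrad : ((r / 2 : NNReal) + (r / 2 : NNReal) : ENNReal) < p.radius := by
    rw [← ENNReal.coe_add, add_halves]
    exact hr.trans_le hp.r_le
  have hsum := p.changeOriginSeries_summable_aux₁ hrad
  -- `T` majorizes the re-expansions of the power series at all centres within `r/2` of `x₀`,
  -- evaluated at radius `r/2`. The part with fixed outer index `m` bounds the `m`-th Taylor
  -- coefficient times `(r/2)^m`, uniformly in the centre.
  set T := ∑' s : Σ k l : ℕ, { s : Finset (Fin (k + l)) // s.card = l },
    ‖p (s.1 + s.2.1)‖₊ * (r / 2) ^ s.2.1 * (r / 2) ^ s.1 with hT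
  refine ⟨r / 2, by positivity, T, (r / 2)⁻¹, by positivity, by positivity, fun x hx => ?_⟩
  have hxr : ‖x - x₀‖₊ ≤ r / 2 := by
    rw [← NNReal.coe_le_coe]; simpa using hx
  have hlt : (‖x - x₀‖₊ : ENNReal) < ρ := by
    refine lt_of_le_of_lt ?_ hr
    exact_mod_cast hxr.trans (NNReal.half_le_self r)
  have hch := hp.changeOrigin hlt
  rw [add_sub_cancel] at hch
  refine ⟨hch.analyticAt, fun m => ?_⟩
  have hfac := hch.factorial_smul 1 m
  have e1 : iteratedDeriv m H x = m.factorial * (p.changeOrigin (x - x₀) m fun _ => 1) := by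
    rw [iteratedDeriv_eq_iteratedFDeriv, ← hfac, nsmul_eq_mul]
  have e2 : |(p.changeOrigin (x - x₀) m fun _ => (1 : ℝ))| ≤ ‖p.changeOrigin (x - x₀) m‖ := by
    simp
  have hlt' : (‖x - x₀‖₊ : ENNReal) < p.radius := hlt.trans_le hp.r_le
  have hhalf : ((r / 2 : NNReal) : ENNReal) < p.radius := lt_of_le_of_lt le_self_add hrad
  have e3 : ‖p.changeOrigin (x - x₀) m‖₊ * (r / 2) ^ m ≤ T := by
    have h1 := p.nnnorm_changeOrigin_le m hlt'
    have h2 := p.changeOriginSeries_summable_aux₂ hhalf m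
    have h3 : ∑' s : Σ l : ℕ, { s : Finset (Fin (m + l)) // s.card = l },
          ‖p (m + s.1)‖₊ * ‖x - x₀‖₊ ^ s.1 ≤
        ∑' s : Σ l : ℕ, { s : Finset (Fin (m + l)) // s.card = l },
          ‖p (m + s.1)‖₊ * (r / 2) ^ s.1 := by
      refine (p.changeOriginSeries_summable_aux₂ hlt' m).tsum_le_tsum (fun s => ?_) h2
      gcongr
    have h4 : (∑' s : Σ l : ℕ, { s : Finset (Fin (m + l)) // s.card = l },
          ‖p (m + s.1)‖₊ * (r / 2) ^ s.1) * (r / 2) ^ m ≤ T := by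
      rw [← NNReal.tsum_mul_right, hT, hsum.tsum_sigma' (NNReal.summable_sigma.1 hsum).1]
      exact (NNReal.summable_sigma.1 hsum).2.le_tsum m (fun _ _ => zero_le)
    calc _ ≤ _ := mul_le_mul_left (h1.trans h3) _
      _ ≤ T := h4
  have e4 : ‖p.changeOrigin (x - x₀) m‖ * ((r : ℝ) / 2) ^ m ≤ T := by exact_mod_cast e3
  rw [e1, abs_mul, Nat.abs_cast, inv_pow]
  have h5 : ‖p.changeOrigin (x - x₀) m‖ ≤ T * (((r : ℝ) / 2) ^ m)⁻¹ := by
    rw [← div_eq_mul_inv, le_div_iff₀ (by positivity)]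
    exact e4
  calc _ ≤ (m.factorial : ℝ) * (T * (((r : ℝ) / 2) ^ m)⁻¹) := by gcongr; exact e2.trans h5
    _ = _ := by ring

/-! ### The singular linear equation `4 s² v' + a v = g` -/

/-- At a maximum point `x > 0` the derivative towards `0` is nonpositive, so `v' x ≥ 0` and `a v ≤
g` there. This also covers `x = L`, so no condition at the right end is needed. -/
theorem le_of_singular_ode {L G : ℝ} {v v' a g : ℝ → ℝ} (hL : 0 ≤ L)
    (hv : ContinuousOn v (Icc 0 L))
    (hd : ∀ s ∈ Ioc 0 L, HasDerivWithinAt v (v' s) (Icc 0 L) s)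
    (ha : ∀ s ∈ Ioc 0 L, 0 < a s)
    (hode : ∀ s ∈ Ioc 0 L, 4 * s ^ 2 * v' s + a s * v s = g s)
    (hg : ∀ s ∈ Ioc 0 L, g s ≤ G * a s) (h0 : v 0 ≤ G) :
    ∀ s ∈ Icc 0 L, v s ≤ G := by
  obtain ⟨x, hx, hmax⟩ := isCompact_Icc.exists_isMaxOn ⟨0, le_rfl, hL⟩ hv
  suffices h : v x ≤ G from fun s hs => (hmax hs).trans h
  rcases eq_or_lt_of_le hx.1 with h | h
  · rwa [← h]
  have hx' : x ∈ Ioc 0 L := ⟨h, hx.2⟩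
  have h1 := hmax.localize.hasFDerivWithinAt_nonpos (hd x hx').hasFDerivWithinAt
    (sub_mem_posTangentConeAt_of_segment_subset
      ((convex_Icc 0 L).segment_subset hx ⟨le_rfl, hL⟩))
  have h2 : 0 ≤ v' x := by
    have h2 : (0 - x) * v' x ≤ 0 := by simpa [mul_comm] using h1
    by_contra! h3
    nlinarith
  have h3 := hode x hx'
  have h4 := hg x hx'
  have h6 : 0 ≤ 4 * x ^ 2 * v' x := by positivity
  refine le_of_mul_le_mul_right ?_ (ha x hx')
  linarith

/-- Maximum principle for the singular linear equation `4 s² v' + a v = g` with `a > 0`. -/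
theorem abs_le_of_singular_ode_of_abs_le_mul {L G : ℝ} {v v' a g : ℝ → ℝ} (hL : 0 ≤ L)
    (hv : ContinuousOn v (Icc 0 L))
    (hd : ∀ s ∈ Ioc 0 L, HasDerivWithinAt v (v' s) (Icc 0 L) s)
    (ha : ∀ s ∈ Ioc 0 L, 0 < a s)
    (hode : ∀ s ∈ Ioc 0 L, 4 * s ^ 2 * v' s + a s * v s = g s)
    (hg : ∀ s ∈ Ioc 0 L, |g s| ≤ G * a s) (h0 : |v 0| ≤ G) :
    ∀ s ∈ Icc 0 L, |v s| ≤ G := by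
  intro s hs
  refine abs_le'.2 ⟨le_of_singular_ode hL hv hd ha hode (fun s hs => (abs_le'.1 (hg s hs)).1)
    (abs_le'.1 h0).1 s hs, ?_⟩
  refine le_of_singular_ode (v := fun s => -v s) (v' := fun s => -v' s) (g := fun s => -g s) hL
    hv.neg (fun s hs => (hd s hs).neg) ha ?_ (fun s hs => (abs_le'.1 (hg s hs)).2)
    (abs_le'.1 h0).2 s hs
  intro s hs
  linarith [hode s hs]

/-- Maximum principle for the singular linear equation `4 s² v' + a v = g` with `a ≥ 1`. -/
theorem abs_le_of_singular_ode {L G : ℝ} {v v' a g : ℝ → ℝ} (hL : 0 ≤ L)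
    (hv : ContinuousOn v (Icc 0 L))
    (hd : ∀ s ∈ Ioc 0 L, HasDerivWithinAt v (v' s) (Icc 0 L) s)
    (ha : ∀ s ∈ Ioc 0 L, 1 ≤ a s)
    (hode : ∀ s ∈ Ioc 0 L, 4 * s ^ 2 * v' s + a s * v s = g s)
    (hg : ∀ s ∈ Ioc 0 L, |g s| ≤ G) (h0 : |v 0| ≤ G) :
    ∀ s ∈ Icc 0 L, |v s| ≤ G :=
  abs_le_of_singular_ode_of_abs_le_mul hL hv hd (fun s hs => one_pos.trans_le (ha s hs)) hode
    (fun s hs => (hg s hs).trans (le_mul_of_one_le_right ((abs_nonneg _).trans h0) (ha s hs))) h0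

/-- The integrating factor of the equation `4 s² v' + (1 + 8 k s) v = g`. -/
noncomputable def singularFactor (k : ℕ) (s : ℝ) : ℝ := expNegInvGlue (4 * s) * s ^ (2 * k)

theorem contDiff_singularFactor (k : ℕ) : ContDiff ℝ 1 (singularFactor k) :=
  (expNegInvGlue.contDiff.comp (contDiff_const.mul contDiff_id)).mul (contDiff_id.pow _)

theorem singularFactor_zero (k : ℕ) : singularFactor k 0 = 0 := by
  simp [singularFactor, expNegInvGlue.zero]

theorem singularFactor_pos (k : ℕ) {s : ℝ} (hs : 0 < s) : 0 < singularFactor k s :=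
  mul_pos (expNegInvGlue.pos_of_pos (by positivity)) (by positivity)

theorem hasDerivAt_singularFactor (k : ℕ) {s : ℝ} (hs : 0 < s) :
    HasDerivAt (singularFactor k) (singularFactor k s * (1 + 8 * k * s) / (4 * s ^ 2)) s := by
  have h1 : HasDerivAt (fun s : ℝ => -(4 * s)⁻¹) (4 / (4 * s) ^ 2) s := by
    have h := ((((hasDerivAt_id s).const_mul 4).inv (by simpa using hs.ne')).neg)
    convert! h using 1
    simp
    ring
  have h2 := h1.exp.mul (hasDerivAt_pow (2 * k) s)
  have h3 : singularFactor k =ᶠ[𝓝 s] fun s => Real.exp (-(4 * s)⁻¹) * s ^ (2 * k) := by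
    filter_upwards [lt_mem_nhds hs] with t ht
    have : ¬ 4 * t ≤ 0 := by linarith
    simp [singularFactor, expNegInvGlue, this]
  refine (h2.congr_of_eventuallyEq h3).congr_deriv ?_
  rw [h3.eq_of_nhds]
  rcases k with _ | k
  · simp; field_simp
  · rw [show 2 * (k + 1) - 1 = 2 * k + 1 by omega]
    push_cast
    field_simp
    ring

/-- The factor `μ` satisfies `μ' = μ (1 + 8ks) / (4s²)`, so variation of constants reads `v(s) =
μ(s)⁻¹ ∫₀ˢ μ' G` with `G = g / (1 + 8kt)`. As `μ' ≥ 0` and `μ(0) = 0`, this is a weighted average of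
`G` over `[0, s]`, whence `v(s) → G(0) = g(0)`. -/
theorem exists_hasDerivAt_singular_ode (k : ℕ) {g : ℝ → ℝ} (hg : Continuous g) :
    ∃ v : ℝ → ℝ, ContinuousOn v (Ici 0) ∧ v 0 = g 0 ∧
      ∀ s, 0 < s → HasDerivAt v ((g s - (1 + 8 * k * s) * v s) / (4 * s ^ 2)) s := by
  set μ := singularFactor k with hμ
  -- Truncating at `0` keeps the denominator positive, so `G` is continuous on the whole line.
  set G : ℝ → ℝ := fun t => g t / (1 + 8 * k * max t 0) with hG
  have hden : ∀ t : ℝ, (1 + 8 * k * max t 0 : ℝ) ≠ 0 := fun t => by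
    have : (0 : ℝ) ≤ max t 0 := le_max_right _ _
    positivity
  have hGc : Continuous G := by
    refine hg.div ?_ hden
    fun_prop
  have hG0 : G 0 = g 0 := by simp [hG]
  have hμ'c : Continuous (deriv μ) := (contDiff_singularFactor k).continuous_deriv le_rfl
  have hμd : Differentiable ℝ μ := (contDiff_singularFactor k).differentiable (by norm_num)
  have hμint : ∀ s, ∫ t in (0 : ℝ)..s, deriv μ t = μ s := fun s => by
    rw [intervalIntegral.integral_deriv_eq_sub (fun t _ => hμd t)
      (hμ'c.intervalIntegrable _ _), hμ, singularFactor_zero, sub_zero]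
  have hμpos : ∀ t, 0 < t → 0 ≤ deriv μ t := fun t ht => by
    rw [(hasDerivAt_singularFactor k ht).deriv]
    have := (singularFactor_pos k ht).le
    positivity
  set v : ℝ → ℝ := fun s => if 0 < s then (∫ t in (0 : ℝ)..s, deriv μ t * G t) / μ s else g 0
    with hv
  have hv0 : v 0 = g 0 := by simp [hv]
  have hvd : ∀ s, 0 < s → HasDerivAt v ((g s - (1 + 8 * k * s) * v s) / (4 * s ^ 2)) s := by
    intro s hs
    have h1 : HasDerivAt (fun s => ∫ t in (0 : ℝ)..s, deriv μ t * G t) (deriv μ s * G s) s :=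
      intervalIntegral.integral_hasDerivAt_right ((hμ'c.mul hGc).intervalIntegrable _ _)
        ((hμ'c.mul hGc).stronglyMeasurableAtFilter _ _) (hμ'c.mul hGc).continuousAt
    have hμs := singularFactor_pos k hs
    have h2 := h1.div (hasDerivAt_singularFactor k hs) hμs.ne'
    have h3 : v =ᶠ[𝓝 s] fun s => (∫ t in (0 : ℝ)..s, deriv μ t * G t) / μ s := by
      filter_upwards [lt_mem_nhds hs] with t ht
      simp [hv, ht]
    refine (h2.congr_of_eventuallyEq h3).congr_deriv ?_
    rw [h3.eq_of_nhds, hμ, (hasDerivAt_singularFactor k hs).deriv]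
    have h4 : G s = g s / (1 + 8 * k * s) := by simp [hG, max_eq_left hs.le]
    have h5 : (1 + 8 * k * s : ℝ) ≠ 0 := by positivity
    rw [h4]
    have h6 := hs.ne'
    have h7 := hμs.ne'
    field_simp
  refine ⟨v, fun s hs => ?_, hv0, hvd⟩
  rcases eq_or_lt_of_le (mem_Ici.1 hs) with rfl | hs
  swap
  · exact (hvd s hs).continuousAt.continuousWithinAt
  rw [Metric.continuousWithinAt_iff]
  intro ε hε
  obtain ⟨δ, hδ, hδ'⟩ := Metric.continuousAt_iff.1 (hGc.continuousAt (x := 0)) (ε / 2) (by positivity)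
  refine ⟨δ, hδ, fun {s} hs hsδ => ?_⟩
  rw [hv0]
  rcases eq_or_lt_of_le (mem_Ici.1 hs) with rfl | hs
  · simpa [hv0] using hε
  have hμs : 0 < μ s := singularFactor_pos k hs
  have h1 : ‖∫ t in (0 : ℝ)..s, deriv μ t * (G t - g 0)‖ ≤ ∫ t in (0 : ℝ)..s, deriv μ t * (ε / 2) := by
    refine intervalIntegral.norm_integral_le_of_norm_le hs.le (Eventually.of_forall fun t ht => ?_)
      ((hμ'c.mul continuous_const).intervalIntegrable _ _)
    rw [norm_mul, Real.norm_of_nonneg (hμpos t ht.1)]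
    refine mul_le_mul_of_nonneg_left ?_ (hμpos t ht.1)
    have := hδ' (x := t) (by
      rw [Real.dist_0_eq_abs, abs_of_pos ht.1]
      rw [Real.dist_0_eq_abs, abs_of_pos hs] at hsδ
      exact ht.2.trans_lt hsδ)
    rw [hG0, Real.dist_eq] at this
    exact this.le
  have h2 : ∫ t in (0 : ℝ)..s, deriv μ t * (G t - g 0)
      = (∫ t in (0 : ℝ)..s, deriv μ t * G t) - μ s * g 0 := by
    simp_rw [mul_sub]
    have e1 : IntervalIntegrable (fun t => deriv μ t * G t) MeasureTheory.volume 0 s :=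
      (hμ'c.mul hGc).intervalIntegrable _ _
    have e2 : IntervalIntegrable (fun t => deriv μ t * g 0) MeasureTheory.volume 0 s :=
      (hμ'c.mul continuous_const).intervalIntegrable _ _
    rw [intervalIntegral.integral_sub e1 e2, intervalIntegral.integral_mul_const, hμint]
  rw [intervalIntegral.integral_mul_const, hμint, h2, Real.norm_eq_abs] at h1
  have h3 : v s - g 0 = ((∫ t in (0 : ℝ)..s, deriv μ t * G t) - μ s * g 0) / μ s := by
    simp only [hv, hs, if_true]
    field_simp
  rw [Real.dist_eq, h3, abs_div, abs_of_pos hμs, div_lt_iff₀ hμs]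
  nlinarith

theorem exists_hasDerivWithinAt_singular_ode {L : ℝ} (hL : 0 < L) (k : ℕ) (g : ℝ → ℝ)
    (hg : ContinuousOn g (Icc 0 L)) :
    ∃ v : ℝ → ℝ, ContinuousOn v (Icc 0 L) ∧ v 0 = g 0 ∧ ∀ s ∈ Ioc 0 L,
      HasDerivWithinAt v ((g s - (1 + 8 * k * s) * v s) / (4 * s ^ 2)) (Icc 0 L) s := by
  obtain ⟨v, hv, h0, hd⟩ := exists_hasDerivAt_singular_ode k (g := IccExtend hL.le ((Icc 0 L).domRestrict g))
    (continuousOn_iff_continuous_domRestrict.1 hg).Icc_extend'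
  have h : ∀ s ∈ Icc 0 L, IccExtend hL.le ((Icc 0 L).domRestrict g) s = g s := fun s hs => by
    rw [IccExtend_of_mem _ _ hs, domRestrict_apply]
  refine ⟨v, hv.mono fun x hx => hx.1, by rw [h0, h 0 ⟨le_rfl, hL.le⟩], fun s hs => ?_⟩
  rw [← h s ⟨hs.1.le, hs.2⟩]
  exact (hd s hs.1).hasDerivWithinAt

/-- The solution of the formally differentiated equation is the derivative of the solution. -/
theorem hasDerivWithinAt_of_singular_ode {L c : ℝ} (hL : 0 < L) (hc : 0 ≤ c)
    {w w' g g' v v' : ℝ → ℝ} (hw : ContinuousOn w (Icc 0 L)) (hw0 : w 0 = g 0)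
    (hwd : ∀ s ∈ Ioc 0 L, HasDerivWithinAt w (w' s) (Icc 0 L) s)
    (hwe : ∀ s ∈ Ioc 0 L, 4 * s ^ 2 * w' s + (1 + c * s) * w s = g s)
    (hg : ∀ s ∈ Icc 0 L, HasDerivWithinAt g (g' s) (Icc 0 L) s)
    (hv : ContinuousOn v (Icc 0 L))
    (hvd : ∀ s ∈ Ioc 0 L, HasDerivWithinAt v (v' s) (Icc 0 L) s)
    (hve : ∀ s ∈ Ioc 0 L, 4 * s ^ 2 * v' s + (1 + (c + 8) * s) * v s = g' s - c * w s) :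
    ∀ s ∈ Icc 0 L, HasDerivWithinAt w (v s) (Icc 0 L) s := by
  -- The residual `z` of the equation for `w`, with `v` in place of `w'`, satisfies `4 s² z' + (1 +
  -- c s) z = 0` and `z(0) = 0`. The maximum principle gives `z = 0`, that is `v = w'` for `s > 0`.
  have hz : ∀ s ∈ Icc 0 L, |4 * s ^ 2 * v s - g s + (1 + c * s) * w s| ≤ 0 := by
    refine abs_le_of_singular_ode (v := fun s => 4 * s ^ 2 * v s - g s + (1 + c * s) * w s)
      (v' := fun s => 4 * (2 * s) * v s + 4 * s ^ 2 * v' s - g' s + (c * w s + (1 + c * s) * w' s))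
      (a := fun s => 1 + c * s) (g := fun _ => 0) hL.le ?_ ?_ ?_ ?_ ?_ ?_
    · have hgc : ContinuousOn g (Icc 0 L) := fun s hs => (hg s hs).continuousWithinAt
      fun_prop
    · intro s hs
      have h1 : HasDerivWithinAt (fun s : ℝ => 4 * s ^ 2) (4 * (2 * s)) (Icc 0 L) s := by
        have := (((hasDerivAt_pow 2 s).const_mul 4)).hasDerivWithinAt (s := Icc 0 L)
        simpa using this
      have h2 : HasDerivWithinAt (fun s : ℝ => 1 + c * s) c (Icc 0 L) s := by
        have := (((hasDerivAt_id s).const_mul c).const_add 1).hasDerivWithinAt (s := Icc 0 L)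
        simpa using this
      exact ((h1.mul (hvd s hs)).sub (hg s ⟨hs.1.le, hs.2⟩)).add (h2.mul (hwd s hs))
    · intro s hs
      have := mul_nonneg hc hs.1.le
      linarith
    · intro s hs
      linear_combination 4 * s ^ 2 * hve s hs + (1 + c * s) * hwe s hs
    · simp
    · simp [hw0]
  have hvw : ∀ s ∈ Ioc 0 L, v s = w' s := by
    intro s hs
    have h1 := abs_nonpos_iff.1 (hz s ⟨hs.1.le, hs.2⟩)
    have h2 := hwe s hs
    have h3 : 4 * s ^ 2 * (v s - w' s) = 0 := by linarith
    have := hs.1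
    have h4 := (mul_eq_zero.1 h3).resolve_left (by positivity)
    linarith
  intro s hs
  rcases eq_or_lt_of_le hs.1 with rfl | hs0
  swap
  · rw [hvw s ⟨hs0, hs.2⟩]
    exact hwd s ⟨hs0, hs.2⟩
  have hda : ∀ s ∈ Ioo 0 L, HasDerivAt w (v s) s := fun s hs => by
    rw [hvw s ⟨hs.1, hs.2.le⟩]
    exact (hwd s ⟨hs.1, hs.2.le⟩).hasDerivAt (Icc_mem_nhds hs.1 hs.2)
  -- At `s = 0` the equation degenerates; the derivative is recovered as the limit of `w' = v` from
  -- the right.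
  refine (hasDerivWithinAt_Ici_of_tendsto_deriv (s := Ioo 0 L)
    (fun s hs => (hda s hs).differentiableAt.differentiableWithinAt)
    ((hw 0 hs).mono Ioo_subset_Icc_self) (Ioo_mem_nhdsGT hL) ?_).mono fun x hx => hx.1
  have h1 : Tendsto v (𝓝[>] 0) (𝓝 (v 0)) := by
    refine (hv 0 hs).mono_left ?_
    rw [← nhdsWithin_Ioo_eq_nhdsGT hL]
    exact nhdsWithin_mono _ Ioo_subset_Icc_self
  refine h1.congr' ?_
  filter_upwards [Ioo_mem_nhdsGT hL] with s hs
  exact (hda s hs).deriv.symm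

/-- Solvability of `4 s² w' + w = f` with Gevrey bounds. -/
theorem GevreyBound.exists_solution {L R N W : ℝ} {f : ℝ → ℝ} (hL : 0 < L) (hR : 0 < R)
    (hf : GevreyBound L R N f) (hW0 : 0 ≤ W) (hW : N + 4 * W / R ≤ W) :
    ∃ w : ℝ → ℝ, GevreyBound L R W w ∧
      ∀ s ∈ Icc 0 L, 4 * s ^ 2 * derivWithin w (Icc 0 L) s + w s = f s := by
  have hu := uniqueDiffOn_Icc hL
  choose! S hSc hS0 hSd using exists_hasDerivWithinAt_singular_ode hL
  set D : ℕ → ℝ → ℝ := fun k => iteratedDerivWithin k f (Icc 0 L) with hD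
  have hDd : ∀ k, ∀ x ∈ Icc 0 L, HasDerivWithinAt (D k) (D (k + 1) x) (Icc 0 L) x :=
    fun k x hx => hf.contDiffOn.hasDerivWithinAt_iteratedDerivWithin hu k hx
  have hDc : ∀ k, ContinuousOn (D k) (Icc 0 L) := fun k x hx => (hDd k x hx).continuousWithinAt
  -- `V k` is the candidate for the `k`-th derivative, defined as the solution of the `k` times
  -- differentiated equation; the term with `V (k - 1)` comes from both derivatives falling on `s²`.
  let V : ℕ → ℝ → ℝ := fun k => Nat.rec (S 0 (D 0))
    (fun k Vk => S (k + 1) fun x => D (k + 1) x - 4 * (k + 1) * k * Vk x) k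
  -- For `k = 0` the truncated index `k - 1` is harmless: its coefficient vanishes.
  set g : ℕ → ℝ → ℝ := fun k x => D k x - 4 * k * (k - 1) * V (k - 1) x with hg
  have hVS : ∀ k, V k = S k (g k) := by
    intro k
    rcases k with _ | k
    · simp [V, hg]
    · simp [V, hg]
  have hVc : ∀ k, ContinuousOn (V k) (Icc 0 L) := by
    intro k
    induction k with
    | zero => exact hSc 0 _ (hDc 0)
    | succ k ih => exact hSc (k + 1) _ ((hDc (k + 1)).sub (continuousOn_const.mul ih))
  have hgc : ∀ k, ContinuousOn (g k) (Icc 0 L) := by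
    intro k
    have := hDc k
    have := hVc (k - 1)
    simp only [hg]
    fun_prop
  have hV0 : ∀ k, V k 0 = g k 0 := fun k => by rw [hVS]; exact hS0 k _ (hgc k)
  have hVd : ∀ k, ∀ s ∈ Ioc 0 L, HasDerivWithinAt (V k)
      ((g k s - (1 + 8 * k * s) * V k s) / (4 * s ^ 2)) (Icc 0 L) s := by
    intro k s hs
    rw [hVS]
    exact hSd k _ (hgc k) s hs
  have hVe : ∀ k : ℕ, ∀ s ∈ Ioc 0 L, 4 * s ^ 2 * ((g k s - (1 + 8 * k * s) * V k s) / (4 * s ^ 2))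
      + (1 + 8 * k * s) * V k s = g k s := by
    intro k s hs
    have := hs.1.ne'
    field_simp
    ring
  have hVV : ∀ k, ∀ s ∈ Icc 0 L, HasDerivWithinAt (V k) (V (k + 1) s) (Icc 0 L) s := by
    intro k
    induction k with
    | zero =>
      refine hasDerivWithinAt_of_singular_ode (c := 8 * (0 : ℕ)) hL (by simp) (hVc 0) (hV0 0)
        (hVd 0) (hVe 0) (g' := D 1) ?_ (hVc 1) (hVd 1) ?_
      · simpa [hg] using hDd 0
      · intro s hs
        have := hVe 1 s hs
        simp [hg] at this ⊢
        linarith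
    | succ k ih =>
      refine hasDerivWithinAt_of_singular_ode (c := 8 * (k + 1 : ℕ)) hL (by positivity)
        (hVc (k + 1)) (hV0 (k + 1)) (hVd (k + 1)) (hVe (k + 1))
        (g' := fun s => D (k + 2) s - 4 * (k + 1) * k * V (k + 1) s) ?_ (hVc (k + 2)) (hVd (k + 2)) ?_
      · intro s hs
        have := (hDd (k + 1) s hs).sub ((ih s hs).const_mul (4 * (k + 1) * k : ℝ))
        refine HasDerivWithinAt.congr (f := D (k + 1) - fun y => (4 * (k + 1) * k : ℝ) * V k y) this ?_ ?_
        · intro x _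
          simp [hg]
        · simp [hg]
      · intro s hs
        have h := hVe (k + 2) s hs
        have e : g (k + 2) s = D (k + 2) s - 4 * (k + 2) * (k + 1) * V (k + 1) s := by
          simp only [hg]
          rw [show k + 2 - 1 = k + 1 by omega]
          push_cast
          ring
        rw [e] at h ⊢
        push_cast at h ⊢
        linear_combination h
  have hit := iteratedDerivWithin_eqOn_of_hasDerivWithinAt hu hVV
  -- The factor `(k+1) k` is absorbed by passing from `(k!)²` to `((k+1)!)²`. One power of `R` is
  -- left over, and `N + 4W/R ≤ W` closes the induction.
  have hgb : ∀ k, ∀ s ∈ Icc 0 L, |V k s| ≤ W * R ^ k * (k.factorial : ℝ) ^ 2 →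
      |g (k + 1) s| ≤ W * R ^ (k + 1) * ((k + 1).factorial : ℝ) ^ 2 := by
    intro k s hs hV
    have h1 := hf.bound (k + 1) s hs
    have h3 : (k + 1 : ℝ) * k * (k.factorial : ℝ) ^ 2 ≤ ((k + 1).factorial : ℝ) ^ 2 := by
      rw [Nat.factorial_succ]
      push_cast
      rw [mul_pow]
      gcongr
      nlinarith
    have h4 : |g (k + 1) s| ≤ |D (k + 1) s| + 4 * (k + 1) * k * |V k s| := by
      have e : g (k + 1) s = D (k + 1) s - 4 * (k + 1) * k * V k s := by simp [hg]
      rw [e]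
      refine (abs_sub _ _).trans ?_
      rw [abs_mul, abs_of_nonneg (by positivity : (0 : ℝ) ≤ 4 * (k + 1) * k)]
    calc |g (k + 1) s| ≤ |D (k + 1) s| + 4 * (k + 1) * k * |V k s| := h4
      _ ≤ N * R ^ (k + 1) * ((k + 1).factorial : ℝ) ^ 2
          + 4 * (k + 1) * k * (W * R ^ k * (k.factorial : ℝ) ^ 2) := by gcongr
      _ = N * R ^ (k + 1) * ((k + 1).factorial : ℝ) ^ 2
          + 4 * W * R ^ k * ((k + 1 : ℝ) * k * (k.factorial : ℝ) ^ 2) := by ring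
      _ ≤ N * R ^ (k + 1) * ((k + 1).factorial : ℝ) ^ 2
          + 4 * W * R ^ k * ((k + 1).factorial : ℝ) ^ 2 := by gcongr
      _ = (N + 4 * W / R) * (R ^ (k + 1) * ((k + 1).factorial : ℝ) ^ 2) := by
        field_simp
        ring
      _ ≤ W * (R ^ (k + 1) * ((k + 1).factorial : ℝ) ^ 2) := by gcongr
      _ = _ := by ring
  have hVmax : ∀ k, (∀ s ∈ Icc 0 L, |g k s| ≤ W * R ^ k * (k.factorial : ℝ) ^ 2) →
      ∀ s ∈ Icc 0 L, |V k s| ≤ W * R ^ k * (k.factorial : ℝ) ^ 2 := by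
    intro k h
    refine abs_le_of_singular_ode hL.le (hVc k) (hVd k) (a := fun s => 1 + 8 * k * s) ?_ (hVe k)
      (fun s hs => h s ⟨hs.1.le, hs.2⟩) ?_
    · intro s hs
      have := hs.1.le
      have : 0 ≤ 8 * k * s := by positivity
      linarith
    · rw [hV0]
      exact h 0 ⟨le_rfl, hL.le⟩
  refine ⟨V 0, ⟨contDiffOn_infty_of_hasDerivWithinAt hu hVV, fun k x hx => ?_⟩, ?_⟩
  · rw [hit k hx]
    revert x
    induction k with
    | zero =>
      refine hVmax 0 fun s hs => ?_
      have h1 := hf.bound 0 s hs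
      have h2 : 0 ≤ 4 * W / R := by positivity
      simp [hg, hD] at h1 ⊢
      linarith
    | succ k ih => exact hVmax (k + 1) fun s hs => hgb k s hs (ih s hs)
  · intro s hs
    rw [← iteratedDerivWithin_one, hit 1 hs]
    rcases eq_or_lt_of_le hs.1 with rfl | hs0
    · simpa [hg, hD] using hV0 0
    · have h := hVe 0 s ⟨hs0, hs.2⟩
      have h1 := (hu s hs).eq_deriv _ (hVd 0 s ⟨hs0, hs.2⟩) (hVV 0 s hs)
      rw [h1] at h
      simpa [hg, hD] using h

/-! ### The nonlinear right-hand side -/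

/-- The right-hand side of the equation `4 s² w' + w = F(s, H(γ), w)` for `w = γ'`. -/
noncomputable def slopeNonlinearity (n : ℕ) (s h w : ℝ) : ℝ :=
  h + (2 * n - 4) * s * w - 4 * s ^ 2 * w ^ 2 * ((1 - 2 * n * s) * w - h)

/-- Every occurrence of `w` carries a factor `s`. The resulting weight on `|w₁ - w₂|` provides the
contraction on short intervals and the absorption in the uniqueness proof. -/
theorem exists_abs_slopeNonlinearity_sub_le (n : ℕ) (A W : ℝ) :
    ∃ K, 0 ≤ K ∧ ∀ s h₁ h₂ w₁ w₂ : ℝ, 0 ≤ s → s ≤ 1 → |h₂| ≤ A → |w₁| ≤ W → |w₂| ≤ W →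
      |slopeNonlinearity n s h₁ w₁ - slopeNonlinearity n s h₂ w₂| ≤
        K * (|h₁ - h₂| + s * |w₁ - w₂|) := by
  refine ⟨1 + 4 * W ^ 2 + (2 * n + 4) + 4 * (1 + 2 * n) * (3 * W ^ 2) + 8 * |A| * |W|,
    by positivity, fun s h₁ h₂ w₁ w₂ hs0 hs1 hh hw₁ hw₂ => ?_⟩
  have hW : 0 ≤ W := (abs_nonneg _).trans hw₁
  have hA : 0 ≤ A := (abs_nonneg _).trans hh
  rw [abs_of_nonneg hW, abs_of_nonneg hA]
  have hn : (0 : ℝ) ≤ n := Nat.cast_nonneg n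
  have e : slopeNonlinearity n s h₁ w₁ - slopeNonlinearity n s h₂ w₂
      = (1 + 4 * (s ^ 2 * w₁ ^ 2)) * (h₁ - h₂) + ((2 * n - 4)
        + -(4 * (s * ((1 - 2 * n * s) * (w₁ ^ 2 + w₁ * w₂ + w₂ ^ 2))))
        + 4 * (s * (h₂ * (w₁ + w₂)))) * (s * (w₁ - w₂)) := by
    unfold slopeNonlinearity; ring
  have h1 : |1 + 4 * (s ^ 2 * w₁ ^ 2)| ≤ 1 + 4 * W ^ 2 := by
    rw [abs_of_nonneg (by positivity)]
    have h2 : w₁ ^ 2 ≤ W ^ 2 := sq_le_sq' (abs_le.1 hw₁).1 (abs_le.1 hw₁).2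
    have h3 : s ^ 2 ≤ 1 := by nlinarith
    nlinarith [mul_le_mul h3 h2 (sq_nonneg _) zero_le_one]
  have h2 : |(1 - 2 * n * s) * (w₁ ^ 2 + w₁ * w₂ + w₂ ^ 2)| ≤ (1 + 2 * n) * (3 * W ^ 2) := by
    rw [abs_mul]
    refine mul_le_mul ?_ ?_ (abs_nonneg _) (by positivity)
    · rw [abs_le]; constructor <;> nlinarith
    · refine (abs_add_le _ _).trans ?_
      refine (add_le_add_left (abs_add_le _ _) _).trans ?_
      rw [abs_mul, abs_pow, abs_pow]
      nlinarith [mul_le_mul hw₁ hw₁ (abs_nonneg _) hW, mul_le_mul hw₁ hw₂ (abs_nonneg _) hW,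
        mul_le_mul hw₂ hw₂ (abs_nonneg _) hW]
  have h3 : |h₂ * (w₁ + w₂)| ≤ A * (2 * W) := by
    rw [abs_mul]
    refine mul_le_mul hh ((abs_add_le _ _).trans (by linarith)) (abs_nonneg _) hA
  have h4 : |(2 * n - 4) + -(4 * (s * ((1 - 2 * n * s) * (w₁ ^ 2 + w₁ * w₂ + w₂ ^ 2))))
        + 4 * (s * (h₂ * (w₁ + w₂)))| ≤
      (2 * n + 4) + 4 * ((1 + 2 * n) * (3 * W ^ 2)) + 4 * (A * (2 * W)) := by
    refine (abs_add_le _ _).trans (add_le_add ((abs_add_le _ _).trans (add_le_add ?_ ?_)) ?_)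
    · rw [abs_le]; constructor <;> linarith
    · rw [abs_neg, abs_mul, abs_mul, abs_of_nonneg hs0, abs_of_pos (by norm_num : (0 : ℝ) < 4)]
      nlinarith [mul_le_of_le_one_left (abs_nonneg
        ((1 - 2 * n * s) * (w₁ ^ 2 + w₁ * w₂ + w₂ ^ 2))) hs1]
    · rw [abs_mul, abs_mul, abs_of_nonneg hs0, abs_of_pos (by norm_num : (0 : ℝ) < 4)]
      nlinarith [mul_le_of_le_one_left (abs_nonneg (h₂ * (w₁ + w₂))) hs1]
  rw [e]
  refine (abs_add_le _ _).trans ?_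
  rw [abs_mul, abs_mul, abs_mul s, abs_of_nonneg hs0, mul_add _ |h₁ - h₂|]
  refine add_le_add (mul_le_mul_of_nonneg_right (h1.trans ?_) (abs_nonneg _))
    (mul_le_mul_of_nonneg_right (h4.trans ?_) (by positivity))
  · have : 0 ≤ (2 * n + 4) + 4 * (1 + 2 * n) * (3 * W ^ 2) + 8 * A * W := by positivity
    linarith
  · nlinarith [sq_nonneg W]

namespace GevreyBound

variable {L R A B W : ℝ}

theorem zero (hA : 0 ≤ A) (hR : 0 ≤ R) : GevreyBound L R A (fun _ => 0) :=
  ⟨contDiffOn_const, fun k x _ => by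
    rw [iteratedDerivWithin_fun_const_zero]
    simp only [abs_zero]
    positivity⟩

theorem id (hL : 0 < L) (hR : 0 < R) (hLR : L ≤ 1 / R) : GevreyBound L R (1 / R) (fun s => s) := by
  refine of_hasDerivWithinAt (w := fun _ => 1) hL hR zero_le_one
    (fun x _ => (hasDerivAt_id x).hasDerivWithinAt)
    (fun x hx => by rw [abs_of_nonneg hx.1]; exact hx.2.trans hLR) ⟨contDiffOn_const, ?_⟩
  intro k x hx
  rw [iteratedDerivWithin_const]
  rcases k with _ | k
  · simp
  · simp only [Nat.succ_ne_zero, if_false, abs_zero]; positivity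

/-- Written through `u = s w`, whose constant is `3W/R`, the nonlinearity is `h + (2n-4) u - 4 u² (w
- 2n u - h)`; all terms but `h` become small as `R` grows. -/
theorem slopeNonlinearity (n : ℕ) {h w : ℝ → ℝ} (hL : 0 < L) (hR : 0 < R) (hLR : L ≤ 1 / R)
    (hh : GevreyBound L R A h) (hw : GevreyBound L R W w) :
    GevreyBound L R (A + |2 * (n : ℝ) - 4| * (3 * (1 / R) * W) +
      |(-4 : ℝ)| * (3 * (3 * (3 * (1 / R) * W) * (3 * (1 / R) * W)) *
        (W + |(-2 * n : ℝ)| * (3 * (1 / R) * W) + |(-1 : ℝ)| * A)))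
      (fun s => _root_.slopeNonlinearity n s (h s) (w s)) := by
  have hu := (GevreyBound.id hL hR hLR).mul hL hR.le hw
  refine ((hh.add hL (hu.const_mul (2 * (n : ℝ) - 4))).add hL
    (((hu.mul hL hR.le hu).mul hL hR.le
      ((hw.add hL (hu.const_mul (-2 * n : ℝ))).add hL (hh.const_mul (-1)))).const_mul (-4))).congr ?_
  intro s _
  simp only [_root_.slopeNonlinearity]
  ring

end GevreyBound

/-! ### Limits of functions with uniformly bounded derivatives -/

theorem exists_tendsto_ultrafilter_of_abs_le (l : Ultrafilter ℕ) {x : ℕ → ℝ} {M : ℝ}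
    (hx : ∀ m, |x m| ≤ M) : ∃ y, Tendsto x l (𝓝 y) ∧ |y| ≤ M := by
  have h1 : ((l.map x : Ultrafilter ℝ) : Filter ℝ) ≤ 𝓟 (Icc (-M) M) := by
    rw [le_principal_iff]
    exact Ultrafilter.mem_map.2 (Eventually.of_forall fun m => abs_le.1 (hx m))
  obtain ⟨y, hy, hy'⟩ := isCompact_Icc.ultrafilter_le_nhds (l.map x) h1
  exact ⟨y, hy', abs_le.2 hy⟩

/-- Differentiability is not preserved by pointwise limits, but a first-order expansion with a
uniform quadratic error is a closed condition, and it implies differentiability. -/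
theorem abs_sub_sub_mul_le_of_hasDerivWithinAt {L M : ℝ} {f f' f'' : ℝ → ℝ}
    (hf : ∀ x ∈ Icc 0 L, HasDerivWithinAt f (f' x) (Icc 0 L) x)
    (hf' : ∀ x ∈ Icc 0 L, HasDerivWithinAt f' (f'' x) (Icc 0 L) x)
    (hM : ∀ x ∈ Icc 0 L, |f'' x| ≤ M) {x y : ℝ} (hx : x ∈ Icc 0 L) (hy : y ∈ Icc 0 L) :
    |f y - f x - f' x * (y - x)| ≤ M * |y - x| ^ 2 := by
  have hsub : uIcc x y ⊆ Icc 0 L := (ordConnected_Icc).uIcc_subset hx hy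
  have hM0 : 0 ≤ M := (abs_nonneg _).trans (hM x hx)
  have h1 : ∀ t ∈ uIcc x y, ‖f' t - f' x‖ ≤ M * |y - x| := by
    intro t ht
    refine ((convex_Icc 0 L).norm_image_sub_le_of_norm_hasDerivWithin_le hf' hM hx (hsub ht)).trans ?_
    exact mul_le_mul_of_nonneg_left (abs_sub_left_of_mem_uIcc ht) hM0
  have h2 : ∀ t ∈ uIcc x y, HasDerivWithinAt (fun t => f t - f' x * t) (f' t - f' x) (uIcc x y) t := by
    intro t ht
    exact (((hf t (hsub ht)).mono hsub).sub
      (((hasDerivAt_id t).const_mul (f' x)).hasDerivWithinAt)).congr_deriv (by simp)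
  have h3 := (convex_uIcc x y).norm_image_sub_le_of_norm_hasDerivWithin_le h2 h1 left_mem_uIcc
    right_mem_uIcc
  rw [Real.norm_eq_abs, Real.norm_eq_abs] at h3
  calc _ = |f y - f' x * y - (f x - f' x * x)| := by congr 1; ring
    _ ≤ _ := h3
    _ = _ := by ring

theorem hasDerivWithinAt_of_abs_sub_sub_mul_le {s : Set ℝ} {M f' x : ℝ} {f : ℝ → ℝ}
    (h : ∀ y ∈ s, |f y - f x - f' * (y - x)| ≤ M * |y - x| ^ 2) : HasDerivWithinAt f f' s x := by
  rw [hasDerivWithinAt_iff_isLittleO, Asymptotics.isLittleO_iff]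
  intro c hc
  have h1 : ∀ᶠ y in 𝓝 x, (|M| + 1) * |y - x| < c := by
    have : Tendsto (fun y : ℝ => (|M| + 1) * |y - x|) (𝓝 x) (𝓝 0) := by
      have : Continuous (fun y : ℝ => (|M| + 1) * |y - x|) := by fun_prop
      simpa using this.tendsto x
    exact this.eventually (gt_mem_nhds hc)
  filter_upwards [self_mem_nhdsWithin, mem_nhdsWithin_of_mem_nhds h1] with y hy hy1
  have h2 := h y hy
  rw [smul_eq_mul, mul_comm (y - x), Real.norm_eq_abs, Real.norm_eq_abs]
  have h3 : M ≤ |M| + 1 := (le_abs_self M).trans (by linarith)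
  have h4 := abs_nonneg (y - x)
  calc _ ≤ _ := h2
    _ ≤ (|M| + 1) * |y - x| ^ 2 := by gcongr
    _ = ((|M| + 1) * |y - x|) * |y - x| := by ring
    _ ≤ c * |y - x| := by gcongr

/-- A sequence of smooth functions with bounded derivatives of every order has a smooth limit along
any ultrafilter, together with all its derivatives. -/
theorem exists_tendsto_iteratedDerivWithin {L : ℝ} (hL : 0 < L) (l : Ultrafilter ℕ)
    {f : ℕ → ℝ → ℝ} (hf : ∀ m, ContDiffOn ℝ ∞ (f m) (Icc 0 L)) {M : ℕ → ℝ}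
    (hM : ∀ m k, ∀ x ∈ Icc 0 L, |iteratedDerivWithin k (f m) (Icc 0 L) x| ≤ M k) :
    ∃ F : ℕ → ℝ → ℝ, (∀ k, ∀ x ∈ Icc 0 L,
        Tendsto (fun m => iteratedDerivWithin k (f m) (Icc 0 L) x) l (𝓝 (F k x))) ∧
      (∀ k, ∀ x ∈ Icc 0 L, |F k x| ≤ M k) ∧
      (∀ k, ∀ x ∈ Icc 0 L, HasDerivWithinAt (F k) (F (k + 1) x) (Icc 0 L) x) := by
  have hu := uniqueDiffOn_Icc hL
  -- Along an ultrafilter bounded sequences converge, so all derivatives at all points have limits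
  -- at once and no diagonal subsequence is needed.
  choose! F hF hFM using fun k x (hx : x ∈ Icc 0 L) =>
    exists_tendsto_ultrafilter_of_abs_le l (fun m => hM m k x hx)
  refine ⟨F, hF, hFM, fun k x hx => hasDerivWithinAt_of_abs_sub_sub_mul_le (M := M (k + 2)) ?_⟩
  intro y hy
  refine le_of_tendsto ((((hF k y hy).sub (hF k x hx)).sub
    ((hF (k + 1) x hx).mul_const (y - x))).abs) (Eventually.of_forall fun m => ?_)
  exact abs_sub_sub_mul_le_of_hasDerivWithinAt
    (fun x hx => (hf m).hasDerivWithinAt_iteratedDerivWithin hu k hx)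
    (fun x hx => (hf m).hasDerivWithinAt_iteratedDerivWithin hu (k + 1) hx)
    (fun x hx => hM m (k + 2) x hx) hx hy

/-! ### Picard iteration in a fixed Gevrey class -/

theorem exists_primitive {L : ℝ} (hL : 0 < L) {w : ℝ → ℝ} (hw : ContinuousOn w (Icc 0 L)) :
    ∃ γ : ℝ → ℝ, γ 0 = 0 ∧ ∀ x ∈ Icc 0 L, HasDerivWithinAt γ (w x) (Icc 0 L) x := by
  have hc : Continuous (IccExtend hL.le ((Icc 0 L).domRestrict w)) :=
    (continuousOn_iff_continuous_domRestrict.1 hw).Icc_extend'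
  refine ⟨fun x => ∫ t in (0 : ℝ)..x, IccExtend hL.le ((Icc 0 L).domRestrict w) t, by simp,
    fun x hx => ?_⟩
  have := (intervalIntegral.integral_hasDerivAt_right (hc.intervalIntegrable 0 x)
    (hc.stronglyMeasurableAtFilter _ _) hc.continuousAt).hasDerivWithinAt (s := Icc 0 L)
  rwa [IccExtend_of_mem _ _ hx, domRestrict_apply] at this

theorem abs_le_mul_of_hasDerivWithinAt {L W : ℝ} (hL : 0 ≤ L) {γ w : ℝ → ℝ} (h0 : γ 0 = 0)
    (hγ : ∀ x ∈ Icc 0 L, HasDerivWithinAt γ (w x) (Icc 0 L) x) (hw : ∀ x ∈ Icc 0 L, |w x| ≤ W)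
    {x : ℝ} (hx : x ∈ Icc 0 L) : |γ x| ≤ W * L := by
  have h := (convex_Icc 0 L).norm_image_sub_le_of_norm_hasDerivWithin_le hγ hw ⟨le_rfl, hL⟩ hx
  rw [h0, sub_zero, sub_zero, Real.norm_eq_abs, Real.norm_eq_abs, abs_of_nonneg hx.1] at h
  exact h.trans (mul_le_mul_of_nonneg_left hx.2 ((abs_nonneg _).trans (hw x hx)))

/-- `γ` is a primitive of `w` on `[0, L]` with `γ 0 = 0`, and `w` has Gevrey bounds. -/
structure IsGevreyPrimitive (L R W : ℝ) (γ w : ℝ → ℝ) : Prop where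
  init : γ 0 = 0
  hasDerivWithinAt : ∀ x ∈ Icc 0 L, HasDerivWithinAt γ (w x) (Icc 0 L) x
  gevreyBound : GevreyBound L R W w

namespace IsGevreyPrimitive

variable {L R W : ℝ} {γ w : ℝ → ℝ}

theorem abs_le (hL : 0 ≤ L) (h : IsGevreyPrimitive L R W γ w) {x : ℝ} (hx : x ∈ Icc 0 L) :
    |γ x| ≤ W * L :=
  abs_le_mul_of_hasDerivWithinAt hL h.init h.hasDerivWithinAt
    (fun _ hx => h.gevreyBound.abs_le hx) hx

theorem iteratedDerivWithin_succ_eq (hL : 0 < L) (h : IsGevreyPrimitive L R W γ w) (k : ℕ) {x : ℝ}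
    (hx : x ∈ Icc 0 L) :
    iteratedDerivWithin (k + 1) γ (Icc 0 L) x = iteratedDerivWithin k w (Icc 0 L) x := by
  rw [iteratedDerivWithin_succ']
  exact iteratedDerivWithin_congr
    (fun y hy => (h.hasDerivWithinAt y hy).derivWithin (uniqueDiffOn_Icc hL y hy)) hx

end IsGevreyPrimitive

/-- One Picard step: freeze `γ, w` on the right and solve the linear equation. The condition `hW`
makes the new slope satisfy the bound with the same `W` and `R`. -/
theorem exists_solution_slope_step {n : ℕ} {H : ℝ → ℝ} {L R A B W δ : ℝ} (hL : 0 < L) (hR : 0 < R)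
    (hB : 0 ≤ B)
    (hH : ∀ x, |x| ≤ δ → AnalyticAt ℝ H x ∧ ∀ m : ℕ, |iteratedDeriv m H x| ≤ A * B ^ m * m.factorial)
    (hLR : L ≤ 1 / R) (hBW : 3 * B * W ≤ R) (hδ : W * L ≤ δ)
    (hW : (A + |2 * (n : ℝ) - 4| * (3 * (1 / R) * W) +
      |(-4 : ℝ)| * (3 * (3 * (3 * (1 / R) * W) * (3 * (1 / R) * W)) *
        (W + |(-2 * n : ℝ)| * (3 * (1 / R) * W) + |(-1 : ℝ)| * A))) + 4 * W / R ≤ W)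
    {γ w : ℝ → ℝ} (h : IsGevreyPrimitive L R W γ w) :
    ∃ γ' w' : ℝ → ℝ, IsGevreyPrimitive L R W γ' w' ∧ ∀ s ∈ Icc 0 L,
      4 * s ^ 2 * derivWithin w' (Icc 0 L) s + w' s = slopeNonlinearity n s (H (γ s)) (w s) := by
  have hγδ : ∀ x ∈ Icc 0 L, |γ x| ≤ δ := fun x hx => (h.abs_le hL.le hx).trans hδ
  have h1 : GevreyBound L R A (fun x => H (γ x)) :=
    GevreyBound.comp hL hR.le hB h.hasDerivWithinAt h.gevreyBound (fun x hx => (hH _ (hγδ x hx)).1)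
      (fun m x hx => (hH _ (hγδ x hx)).2 m) hBW
  obtain ⟨w', hw', he⟩ := (GevreyBound.slopeNonlinearity n hL hR hLR h1 h.gevreyBound).exists_solution
    hL hR (h.gevreyBound.nonneg hL) hW
  obtain ⟨γ', h0, hγ'⟩ := exists_primitive hL hw'.contDiffOn.continuousOn
  exact ⟨γ', w', ⟨h0, hγ', hw'⟩, he⟩

/-- The constants are chosen in the order `A, B` (analyticity of `H` at `0`), `W = A + 1`, then `R`
large, then `L` small. Contraction is needed only for the slopes in the sup norm; the uniform Gevrey
bounds supply limits of all derivatives. -/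
theorem exists_gevrey_solution {n : ℕ} {H : ℝ → ℝ} {d₀ : ℝ} (hH : IsMeanCurvatureProfile H d₀) :
    ∃ L R W : ℝ, 0 < L ∧ L ≤ 1 ∧ 0 < R ∧ R * L ≤ 1 ∧ W * L < d₀ ∧ ∃ γ w : ℝ → ℝ, IsGevreyPrimitive L R W γ w ∧
      (∀ s ∈ Icc 0 L, 0 < w s) ∧
      ∀ s ∈ Icc 0 L, 4 * s ^ 2 * derivWithin w (Icc 0 L) s + w s
        = slopeNonlinearity n s (H (γ s)) (w s) := by
  have h0mem : (0 : ℝ) ∈ Ico 0 d₀ := ⟨le_rfl, hH.pos_d₀⟩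
  obtain ⟨δ, hδ, A, B, hA, hB, hAB⟩ := (hH.analytic 0 h0mem).exists_abs_iteratedDeriv_le
  simp only [sub_zero] at hAB
  set W := A + 1 with hWdef
  have hW0 : 0 < W := by positivity
  -- As `R → ∞` the left side of the self-reproduction condition tends to `A`, which is less than
  -- `W`.
  obtain ⟨R, hR1, hBW, hWR⟩ : ∃ R : ℝ, 1 ≤ R ∧ 3 * B * W ≤ R ∧
      (A + |2 * (n : ℝ) - 4| * (3 * (1 / R) * W) +
      |(-4 : ℝ)| * (3 * (3 * (3 * (1 / R) * W) * (3 * (1 / R) * W)) *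
        (W + |(-2 * n : ℝ)| * (3 * (1 / R) * W) + |(-1 : ℝ)| * A))) + 4 * W / R ≤ W := by
    have ht : Tendsto (fun R : ℝ => (A + |2 * (n : ℝ) - 4| * (3 * (1 / R) * W) +
      |(-4 : ℝ)| * (3 * (3 * (3 * (1 / R) * W) * (3 * (1 / R) * W)) *
        (W + |(-2 * n : ℝ)| * (3 * (1 / R) * W) + |(-1 : ℝ)| * A))) + 4 * W / R) atTop (𝓝 A) := by
      have h1 : Tendsto (fun R : ℝ => 1 / R) atTop (𝓝 0) := by
        simpa using tendsto_inv_atTop_zero (𝕜 := ℝ)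
      have h2 : Continuous fun y : ℝ => (A + |2 * (n : ℝ) - 4| * (3 * y * W) +
        |(-4 : ℝ)| * (3 * (3 * (3 * y * W) * (3 * y * W)) *
        (W + |(-2 * n : ℝ)| * (3 * y * W) + |(-1 : ℝ)| * A))) + 4 * W * y := by fun_prop
      have h3 := (h2.tendsto 0).comp h1
      simp only [mul_zero, zero_mul, add_zero] at h3
      refine h3.congr fun R => ?_
      simp only [Function.comp]
      ring
    have h1 : ∀ᶠ R in atTop, _ ≤ W := ht.eventually (ge_mem_nhds (by linarith : A < W))
    obtain ⟨R, h⟩ := ((eventually_ge_atTop 1).and ((eventually_ge_atTop (3 * B * W)).and h1)).exists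
    exact ⟨R, h.1, h.2.1, h.2.2⟩
  have hR : 0 < R := by linarith
  obtain ⟨K, hK, hKlip⟩ := exists_abs_slopeNonlinearity_sub_le n A W
  have hH0 := hH.pos 0 h0mem
  -- The last two smallness conditions give contraction by `1/2` and `w ≥ H 0 / 2`.
  obtain ⟨L, hL, hL1, hLR, hLδ, hLd, hLK, hLH⟩ : ∃ L : ℝ, 0 < L ∧ 1 * L ≤ 1 ∧ R * L ≤ 1 ∧ W * L ≤ δ ∧
      W * L < d₀ ∧ K * (A * B + 1) * L ≤ 1 / 2 ∧ W * R * L ≤ H 0 / 2 := by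
    have hev : ∀ c d : ℝ, 0 < d → ∀ᶠ L in 𝓝[>] (0 : ℝ), c * L < d := by
      intro c d hd
      have h1 : Tendsto (fun L : ℝ => c * L) (𝓝 0) (𝓝 0) := by
        have : Continuous fun L : ℝ => c * L := by fun_prop
        simpa using this.tendsto 0
      exact (h1.mono_left nhdsWithin_le_nhds).eventually (gt_mem_nhds hd)
    obtain ⟨L, h0, h1, h2, h3, h4, h5, h6⟩ := ((eventually_mem_nhdsWithin (a := (0 : ℝ)) (s := Ioi 0)).and
      ((hev 1 1 one_pos).and ((hev R 1 one_pos).and ((hev W δ hδ).and ((hev W d₀ hH.pos_d₀).and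
        ((hev (K * (A * B + 1)) (1 / 2) (by norm_num)).and
          (hev (W * R) (H 0 / 2) (by positivity)))))))).exists
    exact ⟨L, h0, h1.le, h2.le, h3.le, h4, h5.le, h6.le⟩
  rw [one_mul] at hL1
  have hu := uniqueDiffOn_Icc hL
  have hLR' : L ≤ 1 / R := by rw [le_div_iff₀ hR]; linarith
  have hstep : ∀ p : (ℝ → ℝ) × (ℝ → ℝ), IsGevreyPrimitive L R W p.1 p.2 →
      ∃ q : (ℝ → ℝ) × (ℝ → ℝ), IsGevreyPrimitive L R W q.1 q.2 ∧ ∀ s ∈ Icc 0 L,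
        4 * s ^ 2 * derivWithin q.2 (Icc 0 L) s + q.2 s
          = slopeNonlinearity n s (H (p.1 s)) (p.2 s) := by
    intro p hp
    obtain ⟨γ', w', h1, h2⟩ := exists_solution_slope_step hL hR hB hAB hLR' hBW hLδ hWR hp
    exact ⟨(γ', w'), h1, h2⟩
  choose! next hnext hnexte using hstep
  let p : ℕ → (ℝ → ℝ) × (ℝ → ℝ) := fun m => next^[m] (fun _ => 0, fun _ => 0)
  have hps : ∀ m, p (m + 1) = next (p m) := fun m => Function.iterate_succ_apply' _ _ _
  have hp : ∀ m, IsGevreyPrimitive L R W (p m).1 (p m).2 := by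
    intro m
    induction m with
    | zero =>
      exact ⟨rfl, fun x _ => hasDerivWithinAt_const _ _ _, GevreyBound.zero hW0.le hR.le⟩
    | succ m ih => rw [hps]; exact hnext _ ih
  have hpe : ∀ m, ∀ s ∈ Icc 0 L, 4 * s ^ 2 * derivWithin (p (m + 1)).2 (Icc 0 L) s + (p (m + 1)).2 s
      = slopeNonlinearity n s (H ((p m).1 s)) ((p m).2 s) := by
    intro m
    rw [hps]
    exact hnexte _ (hp m)
  have hγδ : ∀ m, ∀ x ∈ Icc 0 L, |(p m).1 x| ≤ δ := fun m x hx => ((hp m).abs_le hL.le hx).trans hLδ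
  have hwd : ∀ m, ∀ x ∈ Icc 0 L, HasDerivWithinAt (p m).2 (derivWithin (p m).2 (Icc 0 L) x) (Icc 0 L) x := by
    intro m x hx
    exact ((hp m).gevreyBound.contDiffOn.differentiableOn (by simp) x hx).hasDerivWithinAt
  have hHlip : ∀ x y, |x| ≤ δ → |y| ≤ δ → |H x - H y| ≤ A * B * |x - y| := by
    intro x y hx hy
    refine (convex_Icc (-δ) δ).norm_image_sub_le_of_norm_deriv_le
      (fun z hz => (hAB z (abs_le.2 hz)).1.differentiableAt) (fun z hz => ?_) (abs_le.1 hy) (abs_le.1 hx)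
    have := (hAB z (abs_le.2 hz)).2 1
    simpa using this
  have hγdiff : ∀ m ε, (∀ s ∈ Icc 0 L, |(p (m + 1)).2 s - (p m).2 s| ≤ ε) →
      ∀ s ∈ Icc 0 L, |(p (m + 1)).1 s - (p m).1 s| ≤ ε * L := by
    intro m ε h s hs
    exact abs_le_mul_of_hasDerivWithinAt (γ := fun s => (p (m + 1)).1 s - (p m).1 s) hL.le
      (by simp [(hp (m + 1)).init, (hp m).init])
      (fun x hx => ((hp (m + 1)).hasDerivWithinAt x hx).sub ((hp m).hasDerivWithinAt x hx)) h hs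
  -- The difference of consecutive slopes solves the linear equation with the difference of
  -- right-hand sides, so the maximum principle transfers the Lipschitz bound without loss.
  have hdiff : ∀ m, ∀ s ∈ Icc 0 L, |(p (m + 1)).2 s - (p m).2 s| ≤ 2 * W * (1 / 2) ^ m := by
    intro m
    induction m with
    | zero =>
      intro s hs
      have h1 := (hp 1).gevreyBound.abs_le hs
      have h2 := (hp 0).gevreyBound.abs_le hs
      rw [pow_zero, mul_one]
      exact (abs_sub _ _).trans (by linarith)
    | succ m ih =>
      have hrhs : ∀ s ∈ Icc 0 L, |slopeNonlinearity n s (H ((p (m + 1)).1 s)) ((p (m + 1)).2 s) -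
          slopeNonlinearity n s (H ((p m).1 s)) ((p m).2 s)| ≤ 2 * W * (1 / 2) ^ (m + 1) := by
        intro s hs
        set ε := 2 * W * (1 / 2) ^ m with hε
        have h1 := hKlip s (H ((p (m + 1)).1 s)) (H ((p m).1 s)) ((p (m + 1)).2 s) ((p m).2 s) hs.1
          (hs.2.trans hL1) (by simpa using (hAB _ (hγδ m s hs)).2 0)
          ((hp (m + 1)).gevreyBound.abs_le hs) ((hp m).gevreyBound.abs_le hs)
        have h2 := hHlip _ _ (hγδ (m + 1) s hs) (hγδ m s hs)
        have h3 := hγdiff m ε ih s hs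
        have h4 := ih s hs
        have hε0 : 0 ≤ ε := (abs_nonneg _).trans h4
        calc _ ≤ K * (|H ((p (m + 1)).1 s) - H ((p m).1 s)| + s * |(p (m + 1)).2 s - (p m).2 s|) := h1
          _ ≤ K * (A * B * (ε * L) + L * ε) := by
            gcongr
            · exact h2.trans (by gcongr)
            · exact hs.2
          _ = (K * (A * B + 1) * L) * ε := by ring
          _ ≤ 1 / 2 * ε := by gcongr
          _ = _ := by rw [hε]; ring
      refine abs_le_of_singular_ode (v := fun s => (p (m + 1 + 1)).2 s - (p (m + 1)).2 s)
        (v' := fun s => derivWithin (p (m + 1 + 1)).2 (Icc 0 L) s - derivWithin (p (m + 1)).2 (Icc 0 L) s)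
        (a := fun _ => 1) hL.le ?_ ?_ (fun _ _ => le_rfl) ?_ (fun s hs => hrhs s ⟨hs.1.le, hs.2⟩) ?_
      · exact (hp _).gevreyBound.contDiffOn.continuousOn.sub (hp _).gevreyBound.contDiffOn.continuousOn
      · intro s hs
        exact (hwd _ s ⟨hs.1.le, hs.2⟩).sub (hwd _ s ⟨hs.1.le, hs.2⟩)
      · intro s hs
        have h1 := hpe (m + 1) s ⟨hs.1.le, hs.2⟩
        have h2 := hpe m s ⟨hs.1.le, hs.2⟩
        linear_combination h1 - h2
      · have h0 : (0 : ℝ) ∈ Icc 0 L := ⟨le_rfl, hL.le⟩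
        have h1 := hpe (m + 1) 0 h0
        have h2 := hpe m 0 h0
        have h3 := hrhs 0 h0
        rw [← h1, ← h2] at h3
        simpa using h3
  -- the limit of the iterates
  set l : Ultrafilter ℕ := hyperfilter ℕ with hl
  have hsm : ∀ m, ContDiffOn ℝ ∞ (p m).1 (Icc 0 L) := fun m =>
    GevreyBound.contDiffOn_primitive hL (hp m).hasDerivWithinAt (hp m).gevreyBound.contDiffOn
  obtain ⟨F, hF, hFM, hFd⟩ := exists_tendsto_iteratedDerivWithin hL l (f := fun m => (p (m + 1)).1)
    (fun m => hsm (m + 1))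
    (M := fun k => Nat.casesOn k (W * L) fun k => W * R ^ k * (k.factorial : ℝ) ^ 2) (by
      intro m k x hx
      rcases k with _ | k
      · simpa using (hp (m + 1)).abs_le hL.le hx
      · rw [(hp (m + 1)).iteratedDerivWithin_succ_eq hL k hx]
        exact (hp (m + 1)).gevreyBound.bound k x hx)
  have hpow : Tendsto (fun m : ℕ => 2 * W * (1 / 2 : ℝ) ^ m) atTop (𝓝 0) := by
    simpa using (tendsto_pow_atTop_nhds_zero_of_lt_one (by norm_num : (0 : ℝ) ≤ 1 / 2)
      (by norm_num)).const_mul (2 * W)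
  have hpowL : Tendsto (fun m : ℕ => 2 * W * (1 / 2 : ℝ) ^ m * L) atTop (𝓝 0) := by
    simpa using hpow.mul_const L
  -- Consecutive differences tend to `0`, so the iterates on the right of the equation, whose index
  -- is one lower, have the same limit.
  have hγlim : ∀ s ∈ Icc 0 L, Tendsto (fun m => (p m).1 s) l (𝓝 (F 0 s)) := by
    intro s hs
    have h1 : Tendsto (fun m => (p (m + 1)).1 s - (p m).1 s) l (𝓝 0) :=
      (squeeze_zero_norm (fun m => hγdiff m _ (hdiff m) s hs) hpowL).mono_left Nat.hyperfilter_le_atTop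
    have h2 := (hF 0 s hs).sub h1
    simpa using h2
  have hwlim : ∀ s ∈ Icc 0 L, Tendsto (fun m => (p m).2 s) l (𝓝 (F 1 s)) := by
    intro s hs
    have h1 : Tendsto (fun m => (p (m + 1)).2 s - (p m).2 s) l (𝓝 0) :=
      (squeeze_zero_norm (fun m => hdiff m s hs) hpow).mono_left Nat.hyperfilter_le_atTop
    have h2 : Tendsto (fun m => (p (m + 1)).2 s) l (𝓝 (F 1 s)) := by
      refine (hF 1 s hs).congr fun m => ?_
      rw [(hp (m + 1)).iteratedDerivWithin_succ_eq hL 0 hs, iteratedDerivWithin_zero]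
    simpa using h2.sub h1
  have hFd1 : ∀ k, ∀ x ∈ Icc 0 L, HasDerivWithinAt (F (k + 1)) (F (k + 1 + 1) x) (Icc 0 L) x :=
    fun k => hFd (k + 1)
  have hwG : GevreyBound L R W (F 1) := by
    refine ⟨contDiffOn_infty_of_hasDerivWithinAt (F := fun k => F (k + 1)) hu hFd1, fun k x hx => ?_⟩
    rw [iteratedDerivWithin_eqOn_of_hasDerivWithinAt (F := fun k => F (k + 1)) hu hFd1 k hx]
    exact hFM (k + 1) x hx
  have hode : ∀ s ∈ Icc 0 L, 4 * s ^ 2 * derivWithin (F 1) (Icc 0 L) s + F 1 s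
        = slopeNonlinearity n s (H (F 0 s)) (F 1 s) := by
    intro s hs
    rw [(hFd 1 s hs).derivWithin (hu s hs)]
    have h1 : Tendsto (fun m => slopeNonlinearity n s (H ((p m).1 s)) ((p m).2 s)) l
        (𝓝 (slopeNonlinearity n s (H (F 0 s)) (F 1 s))) := by
      have hF0 : |F 0 s| ≤ δ := (hFM 0 s hs).trans hLδ
      have h2 := ((hAB _ hF0).1.continuousAt.tendsto.comp (hγlim s hs))
      have h3 : Continuous fun q : ℝ × ℝ => slopeNonlinearity n s q.1 q.2 := by
        unfold slopeNonlinearity; fun_prop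
      exact (h3.tendsto (H (F 0 s), F 1 s)).comp (h2.prodMk_nhds (hwlim s hs))
    refine tendsto_nhds_unique ?_ h1
    refine (((hF 2 s hs).const_mul (4 * s ^ 2)).add (hF 1 s hs)).congr fun m => ?_
    rw [(hp (m + 1)).iteratedDerivWithin_succ_eq hL 1 hs, (hp (m + 1)).iteratedDerivWithin_succ_eq hL 0 hs,
      iteratedDerivWithin_one, iteratedDerivWithin_zero]
    exact hpe m s hs
  have h0L : (0 : ℝ) ∈ Icc 0 L := ⟨le_rfl, hL.le⟩
  have hF00 : F 0 0 = 0 := by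
    refine tendsto_nhds_unique (hγlim 0 h0L) ?_
    simp only [(hp _).init]
    exact tendsto_const_nhds
  refine ⟨L, R, W, hL, hL1, hR, hLR, hLd, F 0, F 1, ⟨hF00, hFd 0, hwG⟩, fun s hs => ?_, hode⟩
  -- At `s = 0` the equation reduces to `w(0) = H(γ(0))`; positivity then spreads to `[0, L]`
  -- through the bound `W R` on `w'`.
  have h1 : F 1 0 = H 0 := by
    have := hode 0 h0L
    rw [hF00] at this
    simpa [slopeNonlinearity] using this
  have h2 := abs_le_mul_of_hasDerivWithinAt (γ := fun s => F 1 s - F 1 0) (w := F 2) (W := W * R) hL.le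
    (by simp) (fun x hx => (hFd 1 x hx).sub_const _) (fun x hx => by
      have h := hFM 2 x hx
      change |F 2 x| ≤ W * R ^ 1 * ((1 : ℕ).factorial : ℝ) ^ 2 at h
      simpa using h) hs
  rw [h1] at h2
  have := (abs_le.1 (h2.trans hLH)).1
  linarith

/-! ### Uniqueness -/

/-- The linear homogeneous integro-differential inequality satisfied by a difference of slopes
has only the trivial solution. -/
theorem eq_zero_of_singular_ode {L K : ℝ} (hL : 0 < L) (hK : 0 ≤ K) {x y y' : ℝ → ℝ}
    (hx0 : x 0 = 0) (hx : ∀ s ∈ Icc 0 L, HasDerivWithinAt x (y s) (Icc 0 L) s)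
    (hy : ∀ s ∈ Icc 0 L, HasDerivWithinAt y (y' s) (Icc 0 L) s)
    (h : ∀ s ∈ Icc 0 L, |4 * s ^ 2 * y' s + y s| ≤ K * (|x s| + s * |y s|)) :
    ∀ s ∈ Icc 0 L, x s = 0 := by
  -- With `D` the maximum of `|y| e^{-ls}`, integration gives `|x| e^{-ls} ≤ D/l`, and `y e^{-ls}`
  -- solves a singular equation with coefficient `1 + 4ls²`. The summand `4K` gives `K/l ≤ 1/4`, and
  -- `K²` gives `K s ≤ 1/4 + 2ls²`. Hence the right side is at most `(D/2)(1 + 4ls²)`, so `D ≤ D/2`,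
  -- without smallness of `L`.
  set l : ℝ := 4 * K + K ^ 2 + 1 with hl
  have hl0 : 0 < l := by positivity
  have hyc : ContinuousOn y (Icc 0 L) := fun s hs => (hy s hs).continuousWithinAt
  have hc : ContinuousOn (fun s => y s * Real.exp (-l * s)) (Icc 0 L) := by fun_prop
  obtain ⟨t, ht, hmax⟩ := isCompact_Icc.exists_isMaxOn ⟨0, le_rfl, hL.le⟩ hc.abs
  set D := |y t * Real.exp (-l * t)| with hD
  have hD0 : 0 ≤ D := abs_nonneg _
  have hyD : ∀ s ∈ Icc 0 L, |y s| ≤ D * Real.exp (l * s) := by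
    intro s hs
    have := hmax hs
    simp only [mem_ofPred_eq] at this
    rw [← hD, abs_mul, Real.abs_exp, neg_mul, Real.exp_neg, ← div_eq_mul_inv,
      div_le_iff₀ (Real.exp_pos _)] at this
    exact this
  have hxD : ∀ s ∈ Icc 0 L, |x s| ≤ D / l * Real.exp (l * s) := by
    have hxc : ContinuousOn x (Icc 0 L) := fun s hs => (hx s hs).continuousWithinAt
    refine image_norm_le_of_norm_deriv_right_le_deriv_boundary (f' := y)
      (B' := fun s => D * Real.exp (l * s)) hxc (fun s hs => ?_) ?_ (fun s => ?_)
      (fun s hs => hyD s ⟨hs.1, hs.2.le⟩)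
    · refine (hx s ⟨hs.1, hs.2.le⟩).mono_of_mem_nhdsWithin ?_
      exact mem_of_superset (Icc_mem_nhdsGE hs.2) (Icc_subset_Icc_left hs.1)
    · rw [hx0, norm_zero]
      positivity
    · have := (((hasDerivAt_id s).const_mul l).exp).const_mul (D / l)
      refine this.congr_deriv ?_
      simp only [id]
      field_simp
  have hy0 : y 0 = 0 := by
    have := h 0 ⟨le_rfl, hL.le⟩
    simpa [hx0] using this
  have hY : ∀ s ∈ Icc 0 L, |y s * Real.exp (-l * s)| ≤ D / 2 := by
    refine abs_le_of_singular_ode_of_abs_le_mul (v := fun s => y s * Real.exp (-l * s))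
      (v' := fun s => y' s * Real.exp (-l * s) + y s * (Real.exp (-l * s) * -l))
      (a := fun s => 1 + 4 * l * s ^ 2)
      (g := fun s => (4 * s ^ 2 * y' s + y s) * Real.exp (-l * s)) hL.le hc ?_ ?_ ?_ ?_ ?_
    · intro s hs
      have h1 : HasDerivAt (fun s => Real.exp (-l * s)) (Real.exp (-l * s) * -l) s := by
        refine ((hasDerivAt_id s).const_mul (-l)).exp.congr_deriv ?_
        simp
      exact (hy s ⟨hs.1.le, hs.2⟩).mul h1.hasDerivWithinAt
    · intro s hs
      positivity
    · intro s hs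
      ring
    · intro s hs
      have hs' : s ∈ Icc 0 L := ⟨hs.1.le, hs.2⟩
      have hs0 := hs.1.le
      have h1 : |4 * s ^ 2 * y' s + y s| ≤ (K * (D / l) + K * s * D) * Real.exp (l * s) :=
        calc _ ≤ K * (|x s| + s * |y s|) := h s hs'
          _ ≤ K * (D / l * Real.exp (l * s) + s * (D * Real.exp (l * s))) := by
            gcongr
            · exact hxD s hs'
            · exact hyD s hs'
          _ = _ := by ring
      have h2 : K * (D / l) ≤ D / 4 := by
        rw [mul_div_assoc', div_le_iff₀ hl0]
        nlinarith [mul_nonneg hD0 (sq_nonneg K)]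
      have h3 : K * s ≤ 1 / 4 + 2 * l * s ^ 2 := by
        nlinarith [sq_nonneg (1 / 2 - K * s), mul_nonneg hK (sq_nonneg s), sq_nonneg s, sq_nonneg (K * s)]
      have h4 : K * s * D ≤ (1 / 4 + 2 * l * s ^ 2) * D := mul_le_mul_of_nonneg_right h3 hD0
      rw [abs_mul, Real.abs_exp, neg_mul, Real.exp_neg, ← div_eq_mul_inv, div_le_iff₀ (Real.exp_pos _)]
      refine h1.trans (mul_le_mul_of_nonneg_right ?_ (Real.exp_pos _).le)
      linarith
    · simp only [hy0, zero_mul, abs_zero]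
      positivity
  have hD00 : D = 0 := by
    have := hY t ht
    rw [← hD] at this
    linarith
  intro s hs
  have := hxD s hs
  rw [hD00, zero_div, zero_mul] at this
  exact abs_nonpos_iff.1 this

namespace IsSmoothSolution

variable {n : ℕ} {H : ℝ → ℝ} {d₀ L : ℝ} {γ γ₁ γ₂ : ℝ → ℝ}

theorem hasDerivWithinAt (hL : 0 < L) (h : IsSmoothSolution n H d₀ L γ) {s : ℝ} (hs : s ∈ Icc 0 L) :
    HasDerivWithinAt γ (derivWithin γ (Icc 0 L) s) (Icc 0 L) s := by
  have := h.smooth.hasDerivWithinAt_iteratedDerivWithin (uniqueDiffOn_Icc hL) 0 hs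
  simpa using this

theorem hasDerivWithinAt_derivWithin (hL : 0 < L) (h : IsSmoothSolution n H d₀ L γ) {s : ℝ}
    (hs : s ∈ Icc 0 L) :
    HasDerivWithinAt (derivWithin γ (Icc 0 L)) (iteratedDerivWithin 2 γ (Icc 0 L) s) (Icc 0 L) s := by
  have := h.smooth.hasDerivWithinAt_iteratedDerivWithin (uniqueDiffOn_Icc hL) 1 hs
  simpa using this

end IsSmoothSolution

/-- Multiply by the positive denominator `1 + 4 s² w²` and keep only `4 s² w' + w` on the left. -/
theorem singular_ode_iff_slope (n : ℕ) (s h w w' : ℝ) :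
    (1 - 2 * (n : ℝ) * s) * w - h + 4 * ((s * w + s ^ 2 * w') / (1 + 4 * s ^ 2 * w ^ 2)) = 0 ↔
      4 * s ^ 2 * w' + w = slopeNonlinearity n s h w := by
  have hpos : (1 + 4 * s ^ 2 * w ^ 2) ≠ 0 := by positivity
  have e : (1 - 2 * (n : ℝ) * s) * w - h + 4 * ((s * w + s ^ 2 * w') / (1 + 4 * s ^ 2 * w ^ 2))
      = (4 * s ^ 2 * w' + w - slopeNonlinearity n s h w) / (1 + 4 * s ^ 2 * w ^ 2) := by
    rw [slopeNonlinearity]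
    field_simp
    ring
  rw [e, div_eq_zero_iff, or_iff_left hpos, sub_eq_zero]

namespace IsSmoothSolution

variable {n : ℕ} {H : ℝ → ℝ} {d₀ L : ℝ} {γ γ₁ γ₂ : ℝ → ℝ}

/-- For `s > 0` this is the given equation; continuity extends it to `s = 0`, where it forces the
initial slope. -/
theorem slope_equation (hH : IsMeanCurvatureProfile H d₀) (hL : 0 < L)
    (h : IsSmoothSolution n H d₀ L γ) : ∀ s ∈ Icc 0 L,
      4 * s ^ 2 * iteratedDerivWithin 2 γ (Icc 0 L) s + derivWithin γ (Icc 0 L) s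
        = slopeNonlinearity n s (H (γ s)) (derivWithin γ (Icc 0 L) s) := by
  have hu := uniqueDiffOn_Icc hL
  have h1 : ContinuousOn (derivWithin γ (Icc 0 L)) (Icc 0 L) := fun s hs =>
    (h.hasDerivWithinAt_derivWithin hL hs).continuousWithinAt
  have h2 : ContinuousOn (iteratedDerivWithin 2 γ (Icc 0 L)) (Icc 0 L) := fun s hs =>
    (h.smooth.hasDerivWithinAt_iteratedDerivWithin hu 2 hs).continuousWithinAt
  have h3 : ContinuousOn (fun s => H (γ s)) (Icc 0 L) :=
    hH.analytic.continuousOn.comp h.smooth.continuousOn h.mapsTo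
  have hE : EqOn (fun s => 4 * s ^ 2 * iteratedDerivWithin 2 γ (Icc 0 L) s
      + derivWithin γ (Icc 0 L) s)
      (fun s => slopeNonlinearity n s (H (γ s)) (derivWithin γ (Icc 0 L) s)) (Ioc 0 L) :=
    fun s hs => (singular_ode_iff_slope n s _ _ _).1 (h.ode s hs)
  refine hE.of_subset_closure (by fun_prop) ?_ Ioc_subset_Icc_self (by rw [closure_Ioc hL.ne])
  have h4 : Continuous fun q : ℝ × ℝ × ℝ => slopeNonlinearity n q.1 q.2.1 q.2.2 := by
    unfold slopeNonlinearity
    fun_prop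
  exact h4.comp_continuousOn (continuousOn_id.prodMk (h3.prodMk h1))

/-- By compactness both solutions stay in some `[0, c]` with `c < d₀`, where `H` is bounded and
Lipschitz, and both slopes are bounded. So the difference satisfies the inequality of
`eq_zero_of_singular_ode`. -/
theorem eqOn (hH : IsMeanCurvatureProfile H d₀) (hL : 0 < L) (hL1 : L ≤ 1)
    (h₁ : IsSmoothSolution n H d₀ L γ₁) (h₂ : IsSmoothSolution n H d₀ L γ₂) :
    EqOn γ₁ γ₂ (Icc 0 L) := by
  have hne : (Icc (0 : ℝ) L).Nonempty := ⟨0, le_rfl, hL.le⟩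
  obtain ⟨t₁, ht₁, hm₁⟩ := isCompact_Icc.exists_isMaxOn hne h₁.smooth.continuousOn
  obtain ⟨t₂, ht₂, hm₂⟩ := isCompact_Icc.exists_isMaxOn hne h₂.smooth.continuousOn
  set c := max (γ₁ t₁) (γ₂ t₂) with hc
  have hcd : c < d₀ := max_lt (h₁.mapsTo ht₁).2 (h₂.mapsTo ht₂).2
  have hm₁' : ∀ s ∈ Icc 0 L, γ₁ s ∈ Icc 0 c := fun s hs =>
    ⟨(h₁.mapsTo hs).1, (hm₁ hs).trans (le_max_left _ _)⟩
  have hm₂' : ∀ s ∈ Icc 0 L, γ₂ s ∈ Icc 0 c := fun s hs =>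
    ⟨(h₂.mapsTo hs).1, (hm₂ hs).trans (le_max_right _ _)⟩
  have hsub : Icc 0 c ⊆ Ico 0 d₀ := fun x hx => ⟨hx.1, hx.2.trans_lt hcd⟩
  obtain ⟨A, hA⟩ := isCompact_Icc.exists_bound_of_continuousOn (hH.analytic.continuousOn.mono hsub)
  obtain ⟨C, hC⟩ := isCompact_Icc.exists_bound_of_continuousOn
    (hH.analytic.deriv.continuousOn.mono hsub)
  have hw : ∀ {γ}, IsSmoothSolution n H d₀ L γ → ContinuousOn (derivWithin γ (Icc 0 L)) (Icc 0 L) :=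
    fun h s hs => (h.hasDerivWithinAt_derivWithin hL hs).continuousWithinAt
  obtain ⟨W₁, hW₁⟩ := isCompact_Icc.exists_bound_of_continuousOn (hw h₁)
  obtain ⟨W₂, hW₂⟩ := isCompact_Icc.exists_bound_of_continuousOn (hw h₂)
  obtain ⟨K, hK, hlip⟩ := exists_abs_slopeNonlinearity_sub_le n A (max W₁ W₂)
  have hHlip : ∀ x ∈ Icc 0 c, ∀ y ∈ Icc 0 c, |H x - H y| ≤ |C| * |x - y| := fun x hx y hy =>
    (convex_Icc 0 c).norm_image_sub_le_of_norm_deriv_le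
      (fun z hz => (hH.analytic z (hsub hz)).differentiableAt)
      (fun z hz => (hC z hz).trans (le_abs_self C)) hy hx
  have key := eq_zero_of_singular_ode (K := K * (|C| + 1)) hL (by positivity)
    (x := fun s => γ₁ s - γ₂ s) (y := fun s => derivWithin γ₁ (Icc 0 L) s - derivWithin γ₂ (Icc 0 L) s)
    (y' := fun s => iteratedDerivWithin 2 γ₁ (Icc 0 L) s - iteratedDerivWithin 2 γ₂ (Icc 0 L) s)
    (by simp [h₁.init, h₂.init])
    (fun s hs => (h₁.hasDerivWithinAt hL hs).sub (h₂.hasDerivWithinAt hL hs))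
    (fun s hs => (h₁.hasDerivWithinAt_derivWithin hL hs).sub (h₂.hasDerivWithinAt_derivWithin hL hs))
    (fun s hs => by
      have e₁ := h₁.slope_equation hH hL s hs
      have e₂ := h₂.slope_equation hH hL s hs
      have h3 := hlip s (H (γ₁ s)) (H (γ₂ s)) (derivWithin γ₁ (Icc 0 L) s)
        (derivWithin γ₂ (Icc 0 L) s) hs.1 (hs.2.trans hL1) (hA _ (hm₂' s hs))
        ((hW₁ s hs).trans (le_max_left _ _)) ((hW₂ s hs).trans (le_max_right _ _))
      rw [← e₁, ← e₂] at h3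
      have h4 := hHlip _ (hm₁' s hs) _ (hm₂' s hs)
      have hs0 := hs.1
      calc _ = |4 * s ^ 2 * iteratedDerivWithin 2 γ₁ (Icc 0 L) s + derivWithin γ₁ (Icc 0 L) s -
              (4 * s ^ 2 * iteratedDerivWithin 2 γ₂ (Icc 0 L) s + derivWithin γ₂ (Icc 0 L) s)| := by
            congr 1; ring
        _ ≤ _ := h3
        _ ≤ K * ((|C| + 1) * |γ₁ s - γ₂ s|
            + (|C| + 1) * (s * |derivWithin γ₁ (Icc 0 L) s - derivWithin γ₂ (Icc 0 L) s|)) := by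
            refine mul_le_mul_of_nonneg_left (add_le_add (h4.trans ?_) ?_) hK
            · exact mul_le_mul_of_nonneg_right (by linarith) (abs_nonneg _)
            · exact le_mul_of_one_le_left (by positivity) (by linarith [abs_nonneg C])
        _ = _ := by ring)
  intro s hs
  exact sub_eq_zero.1 (key s hs)

end IsSmoothSolution

/-! ### Gevrey regularity of reciprocals, flows and inverse functions -/

namespace GevreyBound

variable {L R C c : ℝ} {f u w : ℝ → ℝ}

/-- Leibniz applied to `w⁻¹ · w = 1` expresses the top derivative of `w⁻¹` through lower ones. The
rate is enlarged so that it exceeds the factor `3CR/c` arising in the induction. -/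
theorem inv (hL : 0 < L) (hR : 0 < R) (hw : GevreyBound L R C w) (hc : 0 < c)
    (hcw : ∀ x ∈ Icc 0 L, c ≤ w x) :
    GevreyBound L (R + 3 * C * R / c) (1 / c) (fun x => (w x)⁻¹) := by
  have hu := uniqueDiffOn_Icc hL
  have hC := hw.nonneg hL
  set R' := R + 3 * C * R / c with hR'
  have hRR' : R ≤ R' := le_add_of_nonneg_right (by positivity)
  have hwpos : ∀ x ∈ Icc 0 L, 0 < w x := fun x hx => hc.trans_le (hcw x hx)
  have hs : ContDiffOn ℝ ∞ (fun x => (w x)⁻¹) (Icc 0 L) :=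
    hw.contDiffOn.inv fun x hx => (hwpos x hx).ne'
  refine ⟨hs, fun k => ?_⟩
  induction k using Nat.strong_induction_on with
  | _ k ih =>
  intro x hx
  rcases k with _ | k
  · simp only [iteratedDerivWithin_zero, pow_zero, mul_one, Nat.factorial_zero, Nat.cast_one, one_pow]
    rw [abs_of_pos (inv_pos.2 (hwpos x hx)), ← one_div]
    exact one_div_le_one_div_of_le hc (hcw x hx)
  have h1 := iteratedDerivWithin_mul (n := k + 1) hx hu ((hs x hx).of_le (by exact_mod_cast le_top))
    ((hw.contDiffOn x hx).of_le (by exact_mod_cast le_top))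
  have h2 : iteratedDerivWithin (k + 1) ((fun x => (w x)⁻¹) * w) (Icc 0 L) x = 0 := by
    rw [iteratedDerivWithin_congr (f := (fun x => (w x)⁻¹) * w) (g := fun _ => (1 : ℝ))
      (fun y hy => inv_mul_cancel₀ (hwpos y hy).ne') hx, iteratedDerivWithin_const]
    simp
  rw [h2, Finset.sum_range_succ] at h1
  simp only [Nat.choose_self, Nat.cast_one, one_mul, Nat.sub_self, iteratedDerivWithin_zero] at h1
  have h3 : |iteratedDerivWithin (k + 1) (fun x => (w x)⁻¹) (Icc 0 L) x| * w x ≤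
      ∑ i ∈ Finset.range (k + 1), 1 / c * C * R * R' ^ k * ((k + 1).factorial : ℝ) ^ 2
        * (1 / ((k + 1).choose i : ℝ)) := by
    have h4 : iteratedDerivWithin (k + 1) (fun x => (w x)⁻¹) (Icc 0 L) x * w x =
        -∑ i ∈ Finset.range (k + 1), ((k + 1).choose i : ℝ) *
          iteratedDerivWithin i (fun x => (w x)⁻¹) (Icc 0 L) x *
            iteratedDerivWithin (k + 1 - i) w (Icc 0 L) x := by linarith
    have h5 : |iteratedDerivWithin (k + 1) (fun x => (w x)⁻¹) (Icc 0 L) x| * w x =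
        |iteratedDerivWithin (k + 1) (fun x => (w x)⁻¹) (Icc 0 L) x * w x| := by
      rw [abs_mul, abs_of_pos (hwpos x hx)]
    rw [h5, h4, abs_neg]
    refine (Finset.abs_sum_le_sum_abs _ _).trans (Finset.sum_le_sum fun i hi => ?_)
    have hi' : i ≤ k := by have := Finset.mem_range.1 hi; omega
    have e1 : ((k + 1).choose i : ℝ) * i.factorial * (k + 1 - i).factorial = (k + 1).factorial := by
      exact_mod_cast Nat.choose_mul_factorial_mul_factorial (show i ≤ k + 1 by omega)
    have e2 : (0 : ℝ) < ((k + 1).choose i : ℝ) := by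
      exact_mod_cast Nat.choose_pos (show i ≤ k + 1 by omega)
    have e3 : R' ^ i * R ^ (k + 1 - i) ≤ R * R' ^ k := by
      rw [show k + 1 - i = (k - i) + 1 by omega, pow_succ' R]
      calc R' ^ i * (R * R ^ (k - i)) ≤ R' ^ i * (R * R' ^ (k - i)) := by gcongr
        _ = R * R' ^ (i + (k - i)) := by rw [pow_add]; ring
        _ = R * R' ^ k := by rw [Nat.add_sub_cancel' hi']
    rw [abs_mul, abs_mul, Nat.abs_cast]
    calc _ ≤ ((k + 1).choose i : ℝ) * (1 / c * R' ^ i * (i.factorial : ℝ) ^ 2) *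
          (C * R ^ (k + 1 - i) * ((k + 1 - i).factorial : ℝ) ^ 2) := by
          gcongr
          · exact ih i (by omega) x hx
          · exact hw.bound (k + 1 - i) x hx
      _ = 1 / c * C * (R' ^ i * R ^ (k + 1 - i)) * (((k + 1).choose i : ℝ) * i.factorial *
          (k + 1 - i).factorial) ^ 2 * (1 / ((k + 1).choose i : ℝ)) := by field_simp
      _ ≤ 1 / c * C * (R * R' ^ k) * (((k + 1).choose i : ℝ) * i.factorial *
          (k + 1 - i).factorial) ^ 2 * (1 / ((k + 1).choose i : ℝ)) := by gcongr
      _ = _ := by rw [e1]; ring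
  rw [← Finset.mul_sum] at h3
  have h6 : ∑ i ∈ Finset.range (k + 1), (1 : ℝ) / ((k + 1).choose i : ℝ) ≤ 3 :=
    le_trans (Finset.sum_le_sum_of_subset_of_nonneg
      (Finset.range_subset_range.2 (by omega)) fun i _ _ => by positivity)
      (sum_inv_choose_le_three (k + 1))
  have h7 : |iteratedDerivWithin (k + 1) (fun x => (w x)⁻¹) (Icc 0 L) x| * c ≤
      (1 / c * R' ^ (k + 1) * ((k + 1).factorial : ℝ) ^ 2) * c :=
    calc _ ≤ |iteratedDerivWithin (k + 1) (fun x => (w x)⁻¹) (Icc 0 L) x| * w x := by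
          gcongr
          exact hcw x hx
      _ ≤ _ := h3
      _ ≤ 1 / c * C * R * R' ^ k * ((k + 1).factorial : ℝ) ^ 2 * 3 := by gcongr
      _ = (1 / c * R' ^ k * ((k + 1).factorial : ℝ) ^ 2 * (3 * C * R / c)) * c := by field_simp
      _ ≤ (1 / c * R' ^ k * ((k + 1).factorial : ℝ) ^ 2 * R') * c := by
          gcongr
          rw [hR']
          linarith
      _ = _ := by ring
  exact le_of_mul_le_mul_right h7 hc

/-- The functions `(u D)^k u`. -/
noncomputable def iterVectorField (L : ℝ) (u : ℝ → ℝ) : ℕ → ℝ → ℝ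
  | 0 => u
  | k + 1 => fun x => u x * derivWithin (iterVectorField L u k) (Icc 0 L) x

/-- Each application of `u D` costs one derivative and a factor `3C`. Enlarging `C(m,i)` to
`C(m+k+1,i)` makes the factorials recombine into `((m+k+1)!)²`. -/
theorem iterVectorField_bound (hL : 0 < L) (hR : 0 ≤ R) (hu : GevreyBound L R C u) (k : ℕ) :
    ContDiffOn ℝ ∞ (iterVectorField L u k) (Icc 0 L) ∧ ∀ m : ℕ, ∀ x ∈ Icc 0 L,
      |iteratedDerivWithin m (iterVectorField L u k) (Icc 0 L) x| ≤
        C * (3 * C) ^ k * R ^ (m + k) * ((m + k).factorial : ℝ) ^ 2 := by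
  have hud := uniqueDiffOn_Icc hL
  have hC := hu.nonneg hL
  induction k with
  | zero => exact ⟨hu.contDiffOn, fun m x hx => by simpa [iterVectorField] using hu.bound m x hx⟩
  | succ k ih =>
    obtain ⟨hs, hb⟩ := ih
    have hds : ContDiffOn ℝ ∞ (derivWithin (iterVectorField L u k) (Icc 0 L)) (Icc 0 L) :=
      hs.derivWithin hud (by simp)
    refine ⟨hu.contDiffOn.mul hds, fun m x hx => ?_⟩
    refine (abs_iteratedDerivWithin_mul_le hud hu.contDiffOn hds m hx
      (fun i _ => hu.bound i x hx)
      (b := fun i => C * (3 * C) ^ k * R ^ (i + 1 + k) * ((i + 1 + k).factorial : ℝ) ^ 2)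
      (fun i _ => by rw [← iteratedDerivWithin_succ']; exact hb (i + 1) x hx)).trans ?_
    have h : ∀ i ∈ Finset.range (m + 1),
        (m.choose i : ℝ) * (C * R ^ i * (i.factorial : ℝ) ^ 2) *
          (C * (3 * C) ^ k * R ^ (m - i + 1 + k) * ((m - i + 1 + k).factorial : ℝ) ^ 2)
        ≤ C * C * (3 * C) ^ k * R ^ (m + (k + 1)) * ((m + (k + 1)).factorial : ℝ) ^ 2
            * (1 / ((m + (k + 1)).choose i : ℝ)) := by
      intro i hi
      have hi' : i ≤ m := by have := Finset.mem_range.1 hi; omega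
      have e : m + (k + 1) - i = m - i + 1 + k := by omega
      have h1 : ((m + (k + 1)).choose i : ℝ) * i.factorial * (m - i + 1 + k).factorial
          = (m + (k + 1)).factorial := by
        have := Nat.choose_mul_factorial_mul_factorial (show i ≤ m + (k + 1) by omega)
        rw [e] at this
        exact_mod_cast this
      have h2 : (0 : ℝ) < ((m + (k + 1)).choose i : ℝ) := by
        exact_mod_cast Nat.choose_pos (show i ≤ m + (k + 1) by omega)
      have h3 : R ^ i * R ^ (m - i + 1 + k) = R ^ (m + (k + 1)) := by rw [← pow_add]; congr 1; omega
      have h4 : (m.choose i : ℝ) ≤ ((m + (k + 1)).choose i : ℝ) := by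
        exact_mod_cast Nat.choose_le_choose i (by omega)
      rw [← h1, ← h3]
      calc _ ≤ ((m + (k + 1)).choose i : ℝ) * (C * R ^ i * (i.factorial : ℝ) ^ 2) *
          (C * (3 * C) ^ k * R ^ (m - i + 1 + k) * ((m - i + 1 + k).factorial : ℝ) ^ 2) := by gcongr
        _ = _ := by field_simp
    refine (Finset.sum_le_sum h).trans ?_
    rw [← Finset.mul_sum]
    have h3 : ∑ i ∈ Finset.range (m + 1), (1 : ℝ) / ((m + (k + 1)).choose i : ℝ) ≤ 3 :=
      le_trans (Finset.sum_le_sum_of_subset_of_nonneg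
        (Finset.range_subset_range.2 (by omega : m + 1 ≤ m + (k + 1) + 1)) fun i _ _ => by positivity)
        (sum_inv_choose_le_three (m + (k + 1)))
    calc _ ≤ C * C * (3 * C) ^ k * R ^ (m + (k + 1)) * ((m + (k + 1)).factorial : ℝ) ^ 2 * 3 := by
          gcongr
      _ = _ := by ring

theorem gevreyOn (hL : 0 < L) (hR : 0 ≤ R) (hf : GevreyBound L R C f) : GevreyOn 2 f 0 L := by
  have hC := hf.nonneg hL
  refine ⟨hf.contDiffOn, C + R + 1, by positivity, fun k x hx => (hf.bound k x hx).trans ?_⟩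
  rw [pow_succ' _ k]
  gcongr <;> linarith

end GevreyBound

/-- A solution on `[0, ℓ]` of the autonomous equation `g' = u(g)` with a Gevrey vector field `u`
is Gevrey. -/
theorem gevreyOn_of_autonomous_ode {L R C ℓ : ℝ} {u g : ℝ → ℝ} (hL : 0 < L) (hR : 0 ≤ R) (hℓ : 0 < ℓ)
    (hu : GevreyBound L R C u) (hg : MapsTo g (Icc 0 ℓ) (Icc 0 L))
    (hd : ∀ x ∈ Icc 0 ℓ, HasDerivWithinAt g (u (g x)) (Icc 0 ℓ) x) : GevreyOn 2 g 0 ℓ := by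
  have hC := hu.nonneg hL
  have hud := uniqueDiffOn_Icc hℓ
  -- By the chain rule `g^{(k+1)} = ((u D)^k u) ∘ g`.
  let F : ℕ → ℝ → ℝ := fun k => Nat.casesOn k g
    fun k x => GevreyBound.iterVectorField L u k (g x)
  have hF : ∀ k, ∀ x ∈ Icc 0 ℓ, HasDerivWithinAt (F k) (F (k + 1) x) (Icc 0 ℓ) x := by
    intro k x hx
    rcases k with _ | k
    · exact hd x hx
    · have hs := (GevreyBound.iterVectorField_bound hL hR hu k).1
      have h1 : HasDerivWithinAt (GevreyBound.iterVectorField L u k)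
          (derivWithin (GevreyBound.iterVectorField L u k) (Icc 0 L) (g x)) (Icc 0 L) (g x) :=
        (hs.differentiableOn (by simp) _ (hg hx)).hasDerivWithinAt
      refine (h1.comp x (hd x hx) hg).congr_deriv ?_
      simp only [F, GevreyBound.iterVectorField]
      ring
  refine ⟨contDiffOn_infty_of_hasDerivWithinAt hud hF, L + C + 3 * C * R + 1, by positivity,
    fun k x hx => ?_⟩
  rw [show g = F 0 from rfl, iteratedDerivWithin_eqOn_of_hasDerivWithinAt (F := F) hud hF k hx]
  rcases k with _ | k
  · change |g x| ≤ _
    simp only [zero_add, pow_one, Nat.factorial_zero, Nat.cast_one, one_pow, mul_one]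
    rw [abs_of_nonneg (hg hx).1]
    have : 0 ≤ 3 * C * R := by positivity
    linarith [(hg hx).2]
  · have h1 := (GevreyBound.iterVectorField_bound hL hR hu k).2 0 (g x) (hg hx)
    simp only [iteratedDerivWithin_zero, zero_add] at h1
    refine h1.trans ?_
    have h2 : C * (3 * C) ^ k * R ^ k = C * (3 * C * R) ^ k := by rw [mul_pow _ R]; ring
    have h3 : (1 : ℝ) ≤ L + C + 3 * C * R + 1 := by
      have : 0 ≤ 3 * C * R := by positivity
      linarith
    have h4 : 0 ≤ 3 * C * R := by positivity
    rw [h2, pow_succ _ (k + 1), pow_succ' _ k]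
    have h5 : C * (3 * C * R) ^ k ≤ (L + C + 3 * C * R + 1) * (L + C + 3 * C * R + 1) ^ k := by
      gcongr <;> linarith
    have h6 : C * (3 * C * R) ^ k ≤
        (L + C + 3 * C * R + 1) * (L + C + 3 * C * R + 1) ^ k * (L + C + 3 * C * R + 1) :=
      h5.trans (le_mul_of_one_le_right (by positivity) h3)
    gcongr
    omega

theorem mul_sub_le_image_sub_of_hasDerivWithinAt {L c : ℝ} {γ w : ℝ → ℝ}
    (hγ : ∀ x ∈ Icc 0 L, HasDerivWithinAt γ (w x) (Icc 0 L) x) (hw : ∀ x ∈ Icc 0 L, c ≤ w x)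
    {x y : ℝ} (hx : x ∈ Icc 0 L) (hy : y ∈ Icc 0 L) (hxy : x ≤ y) : c * (y - x) ≤ γ y - γ x := by
  have hd : ∀ x ∈ interior (Icc 0 L), HasDerivAt γ (w x) x := fun x hx => by
    have := interior_subset hx
    exact (hγ x this).hasDerivAt (mem_interior_iff_mem_nhds.1 hx)
  exact (convex_Icc 0 L).mul_sub_le_image_sub_of_le_deriv
    (fun x hx => (hγ x hx).continuousWithinAt)
    (fun x hx => (hd x hx).differentiableAt.differentiableWithinAt)
    (fun x hx => by rw [(hd x hx).deriv]; exact hw x (interior_subset hx)) x hx y hy hxy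

/-- The inverse of an increasing function with Gevrey bounds on the derivative. -/
theorem IsGevreyPrimitive.exists_inverse {L R W : ℝ} {γ w : ℝ → ℝ} (hL : 0 < L) (hR : 0 < R)
    (h : IsGevreyPrimitive L R W γ w) (hw : ∀ x ∈ Icc 0 L, 0 < w x) :
    ∃ g : ℝ → ℝ, InvOn g γ (Icc 0 L) (Icc 0 (γ L)) ∧ MapsTo γ (Icc 0 L) (Icc 0 (γ L)) ∧
      MapsTo g (Icc 0 (γ L)) (Icc 0 L) ∧
      (∀ d ∈ Icc 0 (γ L), HasDerivWithinAt g (w (g d))⁻¹ (Icc 0 (γ L)) d) ∧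
      0 < γ L ∧ GevreyOn 2 g 0 (γ L) := by
  have hud := uniqueDiffOn_Icc hL
  have h0L : (0 : ℝ) ∈ Icc 0 L := ⟨le_rfl, hL.le⟩
  have hLL : L ∈ Icc 0 L := ⟨hL.le, le_rfl⟩
  have hγc : ContinuousOn γ (Icc 0 L) := fun x hx => (h.hasDerivWithinAt x hx).continuousWithinAt
  obtain ⟨t, ht, hmin⟩ := isCompact_Icc.exists_isMinOn ⟨0, h0L⟩ h.gevreyBound.contDiffOn.continuousOn
  set c := w t with hc
  have hc0 : 0 < c := hw t ht
  have hcw : ∀ x ∈ Icc 0 L, c ≤ w x := fun x hx => hmin hx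
  have hlow := @mul_sub_le_image_sub_of_hasDerivWithinAt L c γ w h.hasDerivWithinAt hcw
  have hmono : StrictMonoOn γ (Icc 0 L) := by
    intro x hx y hy hxy
    have := hlow hx hy hxy.le
    have : 0 < c * (y - x) := mul_pos hc0 (by linarith)
    linarith
  have hℓ : 0 < γ L := by
    have := hmono h0L hLL hL
    rwa [h.init] at this
  have hmaps : MapsTo γ (Icc 0 L) (Icc 0 (γ L)) := fun x hx => by
    refine ⟨?_, hmono.monotoneOn hx hLL hx.2⟩
    rw [← h.init]
    exact hmono.monotoneOn h0L hx hx.1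
  have hsurj : SurjOn γ (Icc 0 L) (Icc 0 (γ L)) := by
    have := intermediate_value_Icc hL.le hγc
    rwa [h.init] at this
  set g := Function.invFunOn γ (Icc 0 L) with hg
  have hinv : InvOn g γ (Icc 0 L) (Icc 0 (γ L)) :=
    ⟨hmono.injOn.leftInvOn_invFunOn, hsurj.rightInvOn_invFunOn⟩
  have hgmaps : MapsTo g (Icc 0 (γ L)) (Icc 0 L) := hsurj.mapsTo_invFunOn
  have hlow' : ∀ x ∈ Icc 0 L, ∀ y ∈ Icc 0 L, c * |y - x| ≤ |γ y - γ x| := by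
    intro x hx y hy
    rcases le_total x y with hxy | hxy
    · rw [abs_of_nonneg (sub_nonneg.2 hxy)]
      exact (hlow hx hy hxy).trans (le_abs_self _)
    · rw [abs_sub_comm, abs_sub_comm (γ y), abs_of_nonneg (sub_nonneg.2 hxy)]
      exact (hlow hy hx hxy).trans (le_abs_self _)
  -- The quadratic Taylor estimate for `γ` is inverted using `c |g e - g d| ≤ |e - d|`; this treats
  -- interior points and end points alike.
  have hgd : ∀ d ∈ Icc 0 (γ L), HasDerivWithinAt g (w (g d))⁻¹ (Icc 0 (γ L)) d := by
    intro d hd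
    refine hasDerivWithinAt_of_abs_sub_sub_mul_le (M := W * R / c / c ^ 2) fun e he => ?_
    have hx := hgmaps hd
    have hy := hgmaps he
    have h1 := abs_sub_sub_mul_le_of_hasDerivWithinAt (M := W * R) h.hasDerivWithinAt
      (fun x hx => by
        have := h.gevreyBound.contDiffOn.hasDerivWithinAt_iteratedDerivWithin hud 0 hx
        rwa [iteratedDerivWithin_zero] at this)
      (fun x hx => by simpa using h.gevreyBound.bound 1 x hx) hx hy
    have h2 := hlow' _ hx _ hy
    rw [hinv.2 hd, hinv.2 he] at h1 h2
    have hwx := hw _ hx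
    have h3 : g e - g d - (w (g d))⁻¹ * (e - d) = -(e - d - w (g d) * (g e - g d)) / w (g d) := by
      field_simp
      ring
    have hWR : 0 ≤ W * R := mul_nonneg (h.gevreyBound.nonneg hL) hR.le
    have h4 : |g e - g d| ≤ |e - d| / c := by rw [le_div_iff₀ hc0]; linarith
    rw [h3, abs_div, abs_neg, abs_of_pos hwx, div_le_iff₀ hwx]
    calc _ ≤ W * R * |g e - g d| ^ 2 := h1
      _ ≤ W * R * (|e - d| / c) ^ 2 := by gcongr
      _ = W * R / c / c ^ 2 * |e - d| ^ 2 * c := by field_simp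
      _ ≤ _ := by
        refine mul_le_mul_of_nonneg_left (hcw _ hx) (by positivity)
  refine ⟨g, hinv, hmaps, hgmaps, hgd, hℓ, ?_⟩
  have hC := h.gevreyBound.nonneg hL
  exact gevreyOn_of_autonomous_ode (u := fun x => (w x)⁻¹) hL (by positivity) hℓ
    (h.gevreyBound.inv hL hR hc0 hcw) hgmaps hgd

/-! ### Rescaling and the energy estimate -/

theorem mapsTo_mul_Icc_div {L r : ℝ} (hr : 0 < r) :
    MapsTo (fun t => r * t) (Icc 0 (L / r)) (Icc 0 L) := fun t ht => by
  have h2 := ht.2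
  rw [le_div_iff₀ hr] at h2
  exact ⟨mul_nonneg hr.le ht.1, by linarith⟩

theorem hasDerivWithinAt_rescaled {L r : ℝ} (hL : 0 < L) (hr : 0 < r) {γ : ℝ → ℝ}
    (hγ : ContDiffOn ℝ ∞ γ (Icc 0 L)) (k : ℕ) {t : ℝ} (ht : t ∈ Icc 0 (L / r)) :
    HasDerivWithinAt (fun t => r ^ k * iteratedDerivWithin k γ (Icc 0 L) (r * t))
      (r ^ (k + 1) * iteratedDerivWithin (k + 1) γ (Icc 0 L) (r * t)) (Icc 0 (L / r)) t := by
  have h1 := hγ.hasDerivWithinAt_iteratedDerivWithin (uniqueDiffOn_Icc hL) k (mapsTo_mul_Icc_div hr ht)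
  have h2 : HasDerivWithinAt (fun t => r * t) r (Icc 0 (L / r)) t := by
    simpa using ((hasDerivAt_id t).const_mul r).hasDerivWithinAt
  refine ((h1.comp t h2 (mapsTo_mul_Icc_div hr)).const_mul (r ^ k)).congr_deriv ?_
  ring

/-- The `j`-th derivative gains `r^j`, while `s ≤ 1/r` and `√s ≤ 1/r` (as `r ≤ 1`) cost at most one
power of `r`; this leaves `(r R)^{j-1}`. -/
theorem energyQuantity_rescaled_le {L R A r : ℝ} (hL : 0 < L) (hL1 : L ≤ 1) (hR : 0 < R) (hr : 0 < r)
    (hr1 : r ≤ 1) {γ : ℝ → ℝ} (hγ : GevreyBound L R A γ) (i : ℕ) {s : ℝ} (hs : s ∈ Icc 0 (L / r)) :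
    energyQuantity (L / r) (fun t => γ (r * t)) (i + 2) s ≤
      A * (r * R) ^ (i + 1) * ((i + 2).factorial : ℝ) ^ 2 * (2 * R + (i + 1)) := by
  have hA := hγ.nonneg hL
  have hLr : 0 < L / r := by positivity
  have hu := uniqueDiffOn_Icc hLr
  let F : ℕ → ℝ → ℝ := fun k t => r ^ k * iteratedDerivWithin k γ (Icc 0 L) (r * t)
  have hF : ∀ k, ∀ t ∈ Icc 0 (L / r), HasDerivWithinAt (F k) (F (k + 1) t) (Icc 0 (L / r)) t :=
    fun k t ht => hasDerivWithinAt_rescaled hL hr hγ.contDiffOn k ht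
  have hFb : ∀ k, ∀ t ∈ Icc 0 (L / r), |F k t| ≤ r ^ k * (A * R ^ k * (k.factorial : ℝ) ^ 2) := by
    intro k t ht
    simp only [F]
    rw [abs_mul, abs_of_pos (by positivity : 0 < r ^ k)]
    gcongr
    exact hγ.bound k _ (mapsTo_mul_Icc_div hr ht)
  have hF0 : (fun t => γ (r * t)) = F 0 := by
    ext t
    simp [F]
  have hit := iteratedDerivWithin_eqOn_of_hasDerivWithinAt hu hF
  -- This is the closed form of `(d/dt)^k (t f')`.
  let G : ℕ → ℝ → ℝ := fun k t => t * F (k + 1) t + k * F k t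
  have hG : ∀ k, ∀ t ∈ Icc 0 (L / r), HasDerivWithinAt (G k) (G (k + 1) t) (Icc 0 (L / r)) t := by
    intro k t ht
    refine (((hasDerivAt_id t).hasDerivWithinAt.mul (hF (k + 1) t ht)).add
      ((hF k t ht).const_mul (k : ℝ))).congr_deriv ?_
    simp only [G, id]
    push_cast
    ring
  have hGit := iteratedDerivWithin_eqOn_of_hasDerivWithinAt hu hG
  have hG0 : EqOn (fun t => t * derivWithin (F 0) (Icc 0 (L / r)) t) (G 0) (Icc 0 (L / r)) := by
    intro t ht
    simp only [G]
    rw [(hF 0 t ht).derivWithin (hu t ht)]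
    simp
  have hrinv : 1 ≤ r⁻¹ := (one_le_inv₀ hr).2 hr1
  have hs1 : s ≤ r⁻¹ := by
    refine hs.2.trans ?_
    rw [div_eq_mul_inv]
    exact mul_le_of_le_one_left (by positivity) hL1
  set B := r ^ (i + 2) * (A * R ^ (i + 2) * ((i + 2).factorial : ℝ) ^ 2) with hB
  have hB0 : 0 ≤ B := by positivity
  have h1 : l2NormUpTo s (iteratedDerivWithin (i + 2) (F 0) (Icc 0 (L / r))) ≤ r⁻¹ * B := by
    unfold l2NormUpTo
    rw [Real.sqrt_le_left (by positivity)]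
    have h2 : ‖∫ t in (0 : ℝ)..s, iteratedDerivWithin (i + 2) (F 0) (Icc 0 (L / r)) t ^ 2‖
        ≤ B ^ 2 * |s - 0| := by
      refine intervalIntegral.norm_integral_le_of_norm_le_const fun t ht => ?_
      rw [uIoc_of_le hs.1] at ht
      have ht' : t ∈ Icc 0 (L / r) := ⟨ht.1.le, ht.2.trans hs.2⟩
      rw [hit (i + 2) ht', norm_pow]
      exact pow_le_pow_left₀ (norm_nonneg _) (hFb (i + 2) t ht') 2
    rw [sub_zero, abs_of_nonneg hs.1] at h2
    refine (le_abs_self _).trans (h2.trans ?_)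
    calc B ^ 2 * s ≤ B ^ 2 * (r⁻¹ * r⁻¹) := by
          gcongr
          exact hs1.trans (le_mul_of_one_le_left (by positivity) hrinv)
      _ = _ := by ring
  have h2 : |iteratedDerivWithin (i + 1) (fun t => t * derivWithin (F 0) (Icc 0 (L / r)) t)
      (Icc 0 (L / r)) s| ≤ r⁻¹ * B
        + (i + 1) * (r ^ (i + 1) * (A * R ^ (i + 1) * ((i + 1).factorial : ℝ) ^ 2)) := by
    rw [iteratedDerivWithin_congr hG0 hs, hGit (i + 1) hs]
    refine (abs_add_le _ _).trans (add_le_add ?_ ?_)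
    · rw [abs_mul, abs_of_nonneg hs.1]
      exact mul_le_mul hs1 (hFb (i + 2) s hs) (abs_nonneg _) (by positivity)
    · rw [abs_mul, Nat.abs_cast]
      push_cast
      gcongr
      exact hFb (i + 1) s hs
  have h3 : r⁻¹ * B = A * (r * R) ^ (i + 1) * ((i + 2).factorial : ℝ) ^ 2 * R := by
    rw [hB, mul_pow, pow_succ r (i + 1), pow_succ R (i + 1)]
    field_simp
  have h4 : ((i + 1).factorial : ℝ) ≤ (i + 2).factorial := by exact_mod_cast Nat.factorial_le (by omega)
  unfold energyQuantity
  rw [hF0]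
  refine (add_le_add h1 h2).trans ?_
  rw [h3]
  calc _ ≤ A * (r * R) ^ (i + 1) * ((i + 2).factorial : ℝ) ^ 2 * R +
        (A * (r * R) ^ (i + 1) * ((i + 2).factorial : ℝ) ^ 2 * R +
        (i + 1) * (r ^ (i + 1) * (A * R ^ (i + 1) * ((i + 2).factorial : ℝ) ^ 2))) := by gcongr
    _ = _ := by rw [mul_pow]; ring

/-- Passing from `(j!)²` to `((j-2)!)²/(j-1)` costs a polynomial of degree six in `j`, dominated by
`64^{j-1}` since `j ≤ 2^{j-1}`. The choice of `r₀` makes `64 r R` beat this and leaves a factor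
`M⁻¹`, which is at most `M^{j-3}` because `M ≥ 1` and `j ≥ 2`. -/
theorem energyQuantity_rescaled_le_zpow {L R A : ℝ} (hL : 0 < L) (hL1 : L ≤ 1) (hR : 0 < R) {γ : ℝ → ℝ}
    (hγ : GevreyBound L R A γ) {M : ℝ} (hM : 1 ≤ M) :
    ∃ r₀ : ℝ, 0 < r₀ ∧ ∀ r : ℝ, 0 < r → r ≤ r₀ → ∀ j : ℕ, 2 ≤ j → ∀ s ∈ Icc 0 (L / r),
      energyQuantity (L / r) (fun t => γ (r * t)) j s
        ≤ M ^ ((j : ℤ) - 3) * ((Nat.factorial (j - 2) : ℝ) ^ 2 / ((j : ℝ) - 1)) := by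
  have hA := hγ.nonneg hL
  have hM0 : 0 < M := by linarith
  set X := A * (1 + 2 * R) with hX
  have hX0 : 0 ≤ X := by positivity
  refine ⟨min 1 (1 / (64 * R * (M * (X + 1)))), by positivity, fun r hr hrr j hj s hs => ?_⟩
  obtain ⟨i, rfl⟩ : ∃ i, j = i + 2 := ⟨j - 2, by omega⟩
  refine (energyQuantity_rescaled_le hL hL1 hR hr (hrr.trans (min_le_left _ _)) hγ i hs).trans ?_
  have hq : 64 * (r * R) ≤ 1 / (M * (X + 1)) := by
    have := hrr.trans (min_le_right _ _)
    rw [le_div_iff₀ (by positivity)] at this ⊢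
    linarith
  have hq1 : 1 / (M * (X + 1)) ≤ 1 := by
    rw [div_le_one (by positivity)]
    nlinarith
  have h2 : ((i : ℝ) + 2) ≤ 2 ^ (i + 1) := by
    have : i + 2 ≤ 2 ^ (i + 1) := Nat.lt_two_pow_self (n := i + 1)
    exact_mod_cast this
  have h3 : ((i : ℝ) + 2) ^ 6 ≤ 64 ^ (i + 1) := by
    calc ((i : ℝ) + 2) ^ 6 ≤ (2 ^ (i + 1)) ^ 6 := by gcongr
      _ = 64 ^ (i + 1) := by rw [← pow_mul, mul_comm, pow_mul]; norm_num
  have h4 : A * (r * R) ^ (i + 1) * (((i + 2) * (i + 1)) ^ 2 * (2 * R + (i + 1)) * (i + 1)) ≤ M⁻¹ :=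
    calc A * (r * R) ^ (i + 1) * (((i + 2 : ℝ) * (i + 1)) ^ 2 * (2 * R + (i + 1)) * (i + 1))
        ≤ A * (r * R) ^ (i + 1) *
          (((i + 2 : ℝ) * (i + 2)) ^ 2 * (2 * R * (i + 2) + (i + 2)) * (i + 2)) := by
          refine mul_le_mul_of_nonneg_left (mul_le_mul (mul_le_mul ?_ ?_ (by positivity)
            (by positivity)) ?_ (by positivity) (by positivity)) (by positivity)
          · gcongr
            norm_num
          · nlinarith [(Nat.cast_nonneg i : (0 : ℝ) ≤ i)]
          · linarith
      _ = X * (r * R) ^ (i + 1) * (i + 2) ^ 6 := by rw [hX]; ring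
      _ ≤ X * (r * R) ^ (i + 1) * 64 ^ (i + 1) := by gcongr
      _ = X * (64 * (r * R)) ^ (i + 1) := by rw [mul_pow 64]; ring
      _ ≤ X * (1 / (M * (X + 1))) ^ (i + 1) := by gcongr
      _ ≤ X * (1 / (M * (X + 1))) := by
          gcongr
          exact pow_le_of_le_one (by positivity) hq1 (by omega)
      _ = M⁻¹ * (X / (X + 1)) := by field_simp
      _ ≤ M⁻¹ * 1 := by
          gcongr
          rw [div_le_one (by positivity)]
          linarith
      _ = M⁻¹ := mul_one _
  have h5 : M⁻¹ ≤ M ^ (((i + 2 : ℕ) : ℤ) - 3) := by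
    rw [← zpow_neg_one]
    exact zpow_le_zpow_right₀ hM (by push_cast; omega)
  have h6 : ((i + 2).factorial : ℝ) = (i + 2) * (i + 1) * i.factorial := by
    rw [Nat.factorial_succ, Nat.factorial_succ]
    push_cast
    ring
  have h7 : ((i + 2 : ℕ) : ℝ) - 1 = i + 1 := by push_cast; ring
  rw [h6, h7, Nat.add_sub_cancel]
  calc A * (r * R) ^ (i + 1) * ((i + 2) * (i + 1) * (i.factorial : ℝ)) ^ 2 * (2 * R + (i + 1))
      = A * (r * R) ^ (i + 1) * (((i + 2) * (i + 1)) ^ 2 * (2 * R + (i + 1)) * (i + 1))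
        * ((i.factorial : ℝ) ^ 2 / (i + 1)) := by field_simp
    _ ≤ _ := by
        gcongr
        exact h4.trans h5

/-! ### The radial graph equation and the main theorem -/

/-- With `s = g(d)` and `φ = -½ log s` one has `φ' = -1/(2 s w)` and `e^{2φ} = 1/s`. After this
substitution the graph equation is the singular equation divided by `2 s w`. -/
theorem solvesRadialGraphEquation_of_inverse {n : ℕ} {H : ℝ → ℝ} {L ℓ : ℝ} {γ w w' g : ℝ → ℝ}
    (hγg : ∀ d ∈ Icc 0 ℓ, γ (g d) = d) (hγ0 : γ 0 = 0) (hγL : γ L = ℓ)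
    (hgmaps : MapsTo g (Icc 0 ℓ) (Icc 0 L)) (hgs : ContDiffOn ℝ ∞ g (Icc 0 ℓ))
    (hgd : ∀ d ∈ Icc 0 ℓ, HasDerivWithinAt g (w (g d))⁻¹ (Icc 0 ℓ) d)
    (hw : ∀ s ∈ Icc 0 L, 0 < w s) (hwd : ∀ s ∈ Icc 0 L, HasDerivWithinAt w (w' s) (Icc 0 L) s)
    (hode : ∀ s ∈ Icc 0 L, 4 * s ^ 2 * w' s + w s = slopeNonlinearity n s (H (γ s)) (w s)) :
    SolvesRadialGraphEquation n H ℓ (fun d => -(1 / 2) * Real.log (g d)) := by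
  have hgo : ∀ d ∈ Ioo 0 ℓ, g d ∈ Ioo 0 L := by
    intro d hd
    have hd' : d ∈ Icc 0 ℓ := ⟨hd.1.le, hd.2.le⟩
    have h1 := hgmaps hd'
    have h2 := hγg d hd'
    refine ⟨lt_of_le_of_ne h1.1 fun h => ?_, lt_of_le_of_ne h1.2 fun h => ?_⟩
    · rw [← h, hγ0] at h2
      exact hd.1.ne h2
    · rw [h, hγL] at h2
      exact hd.2.ne' h2
  have hgd' : ∀ d ∈ Ioo 0 ℓ, HasDerivAt g (w (g d))⁻¹ d := fun d hd =>
    (hgd d ⟨hd.1.le, hd.2.le⟩).hasDerivAt (Icc_mem_nhds hd.1 hd.2)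
  have hwd' : ∀ s ∈ Ioo 0 L, HasDerivAt w (w' s) s := fun s hs =>
    (hwd s ⟨hs.1.le, hs.2.le⟩).hasDerivAt (Icc_mem_nhds hs.1 hs.2)
  have hφ1 : ∀ d ∈ Ioo 0 ℓ, HasDerivAt (fun d => -(1 / 2) * Real.log (g d))
      (-(1 / 2) * (g d * w (g d))⁻¹) d := by
    intro d hd
    refine (((hgd' d hd).log (hgo d hd).1.ne').const_mul (-(1 / 2))).congr_deriv ?_
    rw [mul_inv]
    ring
  refine ⟨?_, fun d hd => ?_⟩
  · refine contDiffOn_const.mul (ContDiffOn.log ?_ fun d hd => (hgo d hd).1.ne')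
    exact_mod_cast contDiffOn_infty.1 (hgs.mono Ioo_subset_Icc_self) 2
  have hs := hgo d hd
  have hs' : g d ∈ Icc 0 L := ⟨hs.1.le, hs.2.le⟩
  have hwp := hw (g d) hs'
  have e1 := (hφ1 d hd).deriv
  have e2 : deriv (deriv fun d => -(1 / 2) * Real.log (g d)) d =
      -(1 / 2) * (-((w (g d))⁻¹ * w (g d) + g d * (w' (g d) * (w (g d))⁻¹)) / (g d * w (g d)) ^ 2) := by
    have h1 : deriv (fun d => -(1 / 2) * Real.log (g d)) =ᶠ[𝓝 d]
        fun d => -(1 / 2) * (g d * w (g d))⁻¹ := by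
      filter_upwards [Ioo_mem_nhds hd.1 hd.2] with t ht
      exact (hφ1 t ht).deriv
    rw [h1.deriv_eq]
    exact ((((hgd' d hd).mul ((hwd' _ hs).comp d (hgd' d hd))).inv
      (mul_pos hs.1 hwp).ne').const_mul (-(1 / 2))).deriv
  have e3 : Real.exp (2 * (-(1 / 2) * Real.log (g d))) = (g d)⁻¹ := by
    rw [show 2 * (-(1 / 2) * Real.log (g d)) = -Real.log (g d) by ring, Real.exp_neg, Real.exp_log hs.1]
  have h1 := (singular_ode_iff_slope n (g d) _ _ _).2 (hode (g d) hs')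
  rw [hγg d ⟨hd.1.le, hd.2.le⟩] at h1
  rw [e1, e2, e3]
  set s := g d
  set v := w s
  have hs0 : s ≠ 0 := hs.1.ne'
  have hv0 : v ≠ 0 := hwp.ne'
  have hpos : 1 + 4 * s ^ 2 * v ^ 2 ≠ 0 := by positivity
  have h2 : (-(1 / 2) * (-(v⁻¹ * v + s * (w' s * v⁻¹)) / (s * v) ^ 2)) / (1 + (-(1 / 2) * (s * v)⁻¹) ^ 2)
      = 2 * (s * v + s ^ 2 * w' s) / (s * v * (1 + 4 * s ^ 2 * v ^ 2)) := by
    have : 1 + (-(1 / 2) * (s * v)⁻¹) ^ 2 = (1 + 4 * s ^ 2 * v ^ 2) / (4 * s ^ 2 * v ^ 2) := by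
      field_simp
      ring
    rw [this]
    field_simp
    ring
  rw [h2]
  have h3 : 4 * ((s * v + s ^ 2 * w' s) / (1 + 4 * s ^ 2 * v ^ 2)) = H d - (1 - 2 * n * s) * v := by
    linarith
  have h4 : 2 * (s * v + s ^ 2 * w' s) / (s * v * (1 + 4 * s ^ 2 * v ^ 2))
      = 4 * ((s * v + s ^ 2 * w' s) / (1 + 4 * s ^ 2 * v ^ 2)) / (2 * (s * v)) := by
    field_simp
    ring
  rw [h4, h3]
  field_simp
  ring

theorem mainTheorem3 (n : ℕ) (H : ℝ → ℝ) (d₀ : ℝ) (hH : IsMeanCurvatureProfile H d₀) :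
    ∃ s₀ : ℝ, 0 < s₀ ∧ ∃ γ : ℝ → ℝ,
      -- `γ` is the unique smooth solution on `[0, s₀]`, and it is strictly increasing
      IsSmoothSolution n H d₀ s₀ γ ∧
      (∀ γ₁ : ℝ → ℝ, IsSmoothSolution n H d₀ s₀ γ₁ → Set.EqOn γ₁ γ (Set.Icc 0 s₀)) ∧
      (∀ s ∈ Set.Icc 0 s₀, 0 < derivWithin γ (Set.Icc 0 s₀) s) ∧
      -- the estimate, for the rescaled solution `s ↦ γ (r s)` on `[0, s₀ / r]`
      (∃ M₀ : ℝ, 0 < M₀ ∧ ∀ M : ℝ, M₀ ≤ M →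
        ∃ r₀ : ℝ, 0 < r₀ ∧ ∀ r : ℝ, 0 < r → r ≤ r₀ →
          ∀ j : ℕ, 2 ≤ j → ∀ s ∈ Set.Icc 0 (s₀ / r),
            energyQuantity (s₀ / r) (fun t => γ (r * t)) j s
              ≤ M ^ ((j : ℤ) - 3) * ((Nat.factorial (j - 2) : ℝ) ^ 2 / ((j : ℝ) - 1))) ∧
      -- Gevrey regularity of `γ`
      GevreyOn 2 γ 0 s₀ ∧
      -- Gevrey regularity of the inverse function `g = e^{-2φ}` on `[0, γ(s₀)]`
      (∃ g φ : ℝ → ℝ,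
        Set.InvOn g γ (Set.Icc 0 s₀) (Set.Icc 0 (γ s₀)) ∧
        Set.MapsTo γ (Set.Icc 0 s₀) (Set.Icc 0 (γ s₀)) ∧
        Set.MapsTo g (Set.Icc 0 (γ s₀)) (Set.Icc 0 s₀) ∧
        (∀ d ∈ Set.Ioc 0 (γ s₀), g d = Real.exp (-2 * φ d)) ∧
        SolvesRadialGraphEquation n H (γ s₀) φ ∧
        GevreyOn 2 g 0 (γ s₀)) := by
  obtain ⟨L, R, W, hL, hL1, hR, hRL, hWL, γ, w, hγ, hw, hode⟩ := exists_gevrey_solution (n := n) hH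
  have hu := uniqueDiffOn_Icc hL
  obtain ⟨g, hinv, hmaps, hgmaps, hgd, hℓ, hgG⟩ := hγ.exists_inverse hL hR hw
  have hW := hγ.gevreyBound.nonneg hL
  -- The bound of order zero uses `|γ| ≤ W L` and `R L ≤ 1`.
  have hγG : GevreyBound L R (W / R) γ := by
    refine GevreyBound.of_hasDerivWithinAt hL hR hW hγ.hasDerivWithinAt (fun x hx => ?_) hγ.gevreyBound
    refine (hγ.abs_le hL.le hx).trans ?_
    rw [le_div_iff₀ hR]
    calc W * L * R = W * (R * L) := by ring
      _ ≤ W * 1 := by gcongr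
      _ = W := mul_one W
  have hγ' : ∀ s ∈ Icc 0 L, derivWithin γ (Icc 0 L) s = w s := fun s hs =>
    (hγ.hasDerivWithinAt s hs).derivWithin (hu s hs)
  have hγ'' : ∀ s ∈ Icc 0 L, iteratedDerivWithin 2 γ (Icc 0 L) s = derivWithin w (Icc 0 L) s := by
    intro s hs
    rw [hγ.iteratedDerivWithin_succ_eq hL 1 hs, iteratedDerivWithin_one]
  have hsol : IsSmoothSolution n H d₀ L γ := by
    refine ⟨hγG.contDiffOn, hγ.init, fun s hs => ⟨(hmaps hs).1, ?_⟩, fun s hs => ?_⟩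
    · exact (le_abs_self _).trans_lt ((hγ.abs_le hL.le hs).trans_lt hWL)
    · have hs' : s ∈ Icc 0 L := ⟨hs.1.le, hs.2⟩
      rw [hγ' s hs', hγ'' s hs']
      exact (singular_ode_iff_slope n s _ _ _).2 (hode s hs')
  refine ⟨L, hL, γ, hsol, fun γ₁ h₁ => h₁.eqOn hH hL hL1 hsol, fun s hs => ?_,
    -- `M₀ = 1` suffices, since all further smallness is put into `r₀`, which may depend on `M`.
    ⟨1, one_pos, fun M hM => energyQuantity_rescaled_le_zpow hL hL1 hR hγG hM⟩,
    hγG.gevreyOn hL hR.le, g, fun d => -(1 / 2) * Real.log (g d), hinv, hmaps, hgmaps, fun d hd => ?_,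
    ?_, hgG⟩
  · rw [hγ' s hs]
    exact hw s hs
  · have hd' : d ∈ Icc 0 (γ L) := ⟨hd.1.le, hd.2⟩
    have hg0 : 0 < g d := by
      refine lt_of_le_of_ne (hgmaps hd').1 fun h => ?_
      have := hinv.2 hd'
      rw [← h, hγ.init] at this
      exact hd.1.ne this
    rw [show -2 * (-(1 / 2) * Real.log (g d)) = Real.log (g d) by ring, Real.exp_log hg0]
  · refine solvesRadialGraphEquation_of_inverse (fun d hd => hinv.2 hd) hγ.init rfl hgmaps hgG.1 hgd hw
      (fun s hs => ?_) hode
    exact (hγ.gevreyBound.contDiffOn.differentiableOn (by simp) s hs).hasDerivWithinAt
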